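/- Let $d\ge 1$, let $\alpha_1,\dots,\alpha_d>0$, and put $A=\operatorname{diag}(\alpha_1,\dots,\alpha_d)$. For $u=1,2,\dots$ let $N(u)=(n_1(u),\dots,n_d(u))$ be a $d$-tuple of positive integers such that $n_j(u)/u\to\alpha_j$ as $u\to\infty$ for every $j$. For a $d$-tuple $N=(n_1,\dots,n_d)$ of positive integers put $V(N)=n_1\cdots n_d$. Let $\{\Lambda_j\}$ be the eigenvalues, with multiplicity, of the Laplacian $\Delta_{DT,N}f(x)=\sum_{j=1}^d\bigl(2f(x)-f(x+e_j)-f(x-e_j)\bigr)$ on the functions on the discrete torus $\prod_{j=1}^d\mathbf Z/n_j\mathbf Z$, and put $\det^*\Delta_{DT,N}=\prod_{\Lambda_j\ne0}\Lambda_j$ and $\theta_N(t)=\sum_j e^{-\Lambda_jt}$. Let $I_0$ be the modified Bessel function $I_0(t)=\sum_{k\ge0}(t/2)^{2k}/(k!)^2$, and put $$\mathcal I_d(0)=-\int_0^\infty\left(e^{-2dt}I_0(2t)^d-e^{-t}\right)\frac{dt}{t},\qquad \mathcal H_N(0)=-\int_0^\infty\left(\theta_N(t)-V(N)e^{-2dt}I_0(2t)^d-1+e^{-t}\right)\frac{dt}{t}.$$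 Let $\Theta_A(t)=\sum_{m\in\mathbf Z^d}\exp\bigl(-(2\pi)^2\,t\sum_{j}m_j^2/\alpha_j^2\bigr)$, $t>0$, be the theta function of the real torus $A\mathbf Z^d\backslash\mathbf R^d$ (the numbers $(2\pi)^2\sum_jm_j^2/\alpha_j^2$ being the eigenvalues of its Laplacian $-\sum_j\partial^2/\partial y_j^2$). Let $\zeta_A$ be its spectral zeta function, that is, the meromorphic continuation to $\mathbf C$, holomorphic away from $d/2$, of $$\zeta_A(s)=\frac1{\Gamma(s)}\int_0^\infty\left(\Theta_A(t)-1\right)t^s\,\frac{dt}{t},\qquad \operatorname{Re}s>d/2,$$ and put $\log\det^*\Delta_{RT,A}=-\zeta_A'(0)$. Then the series and integrals above converge absolutely, the continuation $\zeta_A$ exists, and $$\log\det{}^*\Delta_{DT,N(u)}=V(N(u))\,\mathcal I_d(0)+\log u^2+\log\det{}^*\Delta_{RT,A}+o(1)\qquad\text{as }u\to\infty.$$ Equivalently, $$\mathcal H_{N(u)}(0)=\log u^2-\zeta_A'(0)+o(1)\qquad\text{as }u\to\infty.$$ Moreover, $$\mathcal I_d(0)=\log 2d-\int_0^\infty e^{-2dt}\left(I_0(2t)^d-1\right)\frac{dt}{t}=\log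 2d-\int_0^\infty e^{-dt}\left(I_0(t)^d-1\right)\frac{dt}{t},$$ with absolutely convergent integrals. -/

import Mathlib

open Filter Topology Set MeasureTheory Asymptotics
open scoped Matrix Nat

noncomputable section

namespace DiscreteTorus

/-- The modified Bessel function of the first kind of integral order `n ≥ 0`, given by its
everywhere convergent power series. -/
def besselI (n : ℕ) (t : ℝ) : ℝ :=
  ∑' k : ℕ, (t / 2) ^ (2 * k + n) / ((k ! : ℝ) * ((k + n)! : ℝ))

/-- The vertices of the discrete torus with `N j` points in the `j`-th direction. -/
abbrev Vertex {d : ℕ} (N : Fin d → ℕ+) : Type := ∀ j : Fin d, ZMod (N j : ℕ)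

/-- The combinatorial Laplacian on the discrete torus: the sum over the coordinate directions of
`2 f(x) - (f(x + e_j) + f(x - e_j))`. -/
def laplacian {d : ℕ} (N : Fin d → ℕ+) : (Vertex N → ℝ) →ₗ[ℝ] (Vertex N → ℝ) where
  toFun f x := ∑ j : Fin d, (2 * f x - (f (x + Pi.single j 1) + f (x - Pi.single j 1)))
  map_add' f g := by
    funext x
    simp only [Pi.add_apply, ← Finset.sum_add_distrib]
    exact Finset.sum_congr rfl fun j _ => by ring
  map_smul' c f := by
    funext x
    simp only [Pi.smul_apply, smul_eq_mul, RingHom.id_apply, Finset.mul_sum]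
    exact Finset.sum_congr rfl fun j _ => by ring

/-- The eigenvalues of the Laplacian on the discrete torus, listed with multiplicity. (The
operator is symmetric, so that all its eigenvalues are real.) -/
def eigenvalues {d : ℕ} (N : Fin d → ℕ+) : Multiset ℝ := (laplacian N).charpoly.roots

open Classical in
/-- The product, with multiplicity, of the non-zero eigenvalues of the discrete Laplacian. -/
def detStar {d : ℕ} (N : Fin d → ℕ+) : ℝ := ((eigenvalues N).filter (fun x => x ≠ 0)).prod

/-- The theta function (trace of the heat kernel) of the discrete torus. -/
def theta {d : ℕ} (N : Fin d → ℕ+) (t : ℝ) : ℝ :=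
  ((eigenvalues N).map fun x => Real.exp (-x * t)).sum

/-- The number of vertices of the discrete torus. -/
def vol {d : ℕ} (N : Fin d → ℕ+) : ℝ := ∏ j : Fin d, (N j : ℝ)

/-- The integrand of `𝓘_d(0)`, with respect to `dt` on `(0, ∞)`. -/
def leadIntegrand (d : ℕ) (t : ℝ) : ℝ :=
  (Real.exp (-(2 * d * t)) * besselI 0 (2 * t) ^ d - Real.exp (-t)) / t

/-- The constant `𝓘_d(0)`. -/
def leadConst (d : ℕ) : ℝ := -∫ t in Ioi (0 : ℝ), leadIntegrand d t

/-- The integrand of `𝓗_N(0)`, with respect to `dt` on `(0, ∞)`. -/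
def remIntegrand {d : ℕ} (N : Fin d → ℕ+) (t : ℝ) : ℝ :=
  (theta N t - vol N * Real.exp (-(2 * d * t)) * besselI 0 (2 * t) ^ d - 1 + Real.exp (-t)) / t

/-- The quantity `𝓗_N(0)`. -/
def remTerm {d : ℕ} (N : Fin d → ℕ+) : ℝ := -∫ t in Ioi (0 : ℝ), remIntegrand N t

end DiscreteTorus

namespace RealTorus

/-- The eigenvalue of `-∑ ∂²/∂y_j²` on `ℝ^d / A ℤ^d` belonging to the character
`y ↦ exp (2 π i ⟪ξ, y⟫)`, where `ξ = (Aᵀ)⁻¹ m`, `m ∈ ℤ^d`, runs through the dual lattice. -/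
def eigenvalue {d : ℕ} (A : Matrix (Fin d) (Fin d) ℝ) (m : Fin d → ℤ) : ℝ :=
  (2 * Real.pi) ^ 2 *
    ((Aᵀ⁻¹ *ᵥ fun j => (m j : ℝ)) ⬝ᵥ (Aᵀ⁻¹ *ᵥ fun j => (m j : ℝ)))

/-- The theta function (trace of the heat kernel) of the real torus `ℝ^d / A ℤ^d`. -/
def theta {d : ℕ} (A : Matrix (Fin d) (Fin d) ℝ) (t : ℝ) : ℝ :=
  ∑' m : Fin d → ℤ, Real.exp (-eigenvalue A m * t)

/-- `Z` is (the meromorphic continuation of) the spectral zeta function of `ℝ^d / A ℤ^d`: it is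
meromorphic on `ℂ`, holomorphic away from `d / 2`, and for `Re s > d / 2` it is
`Γ(s)⁻¹ ∫₀^∞ (Θ_A(t) - 1) t^s dt / t`, the integral being absolutely convergent. -/
def IsSpectralZeta {d : ℕ} (A : Matrix (Fin d) (Fin d) ℝ) (Z : ℂ → ℂ) : Prop :=
  MeromorphicOn Z univ ∧ DifferentiableOn ℂ Z {(d / 2 : ℂ)}ᶜ ∧
    ∀ s : ℂ, (d / 2 : ℝ) < s.re →
      MellinConvergent (fun t => ((theta A t - 1 : ℝ) : ℂ)) s ∧
        Z s = (Complex.Gamma s)⁻¹ * mellin (fun t => ((theta A t - 1 : ℝ) : ℂ)) s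

/-- The continuation is unique away from `d / 2`. -/
theorem IsSpectralZeta.eqOn {d : ℕ} {A : Matrix (Fin d) (Fin d) ℝ} {Z W : ℂ → ℂ}
    (hZ : IsSpectralZeta A Z) (hW : IsSpectralZeta A W) : EqOn Z W {(d / 2 : ℂ)}ᶜ := by
  have hpre : IsPreconnected ({(d / 2 : ℂ)}ᶜ : Set ℂ) :=
    (isConnected_compl_singleton_of_one_lt_rank (by simp) _).isPreconnected
  have hmem : (d / 2 + 1 : ℂ) ∈ ({(d / 2 : ℂ)}ᶜ : Set ℂ) := by simp
  refine (hZ.2.1.analyticOnNhd isOpen_compl_singleton).eqOn_of_preconnected_of_eventuallyEq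
    (hW.2.1.analyticOnNhd isOpen_compl_singleton) hpre hmem ?_
  have hopen : IsOpen {s : ℂ | (d / 2 : ℝ) < s.re} :=
    isOpen_lt continuous_const Complex.continuous_re
  have hin : (d / 2 + 1 : ℂ) ∈ {s : ℂ | (d / 2 : ℝ) < s.re} := by
    have : (d / 2 + 1 : ℂ) = ((d / 2 + 1 : ℝ) : ℂ) := by push_cast; ring
    show (d / 2 : ℝ) < (d / 2 + 1 : ℂ).re
    rw [this, Complex.ofReal_re]
    linarith
  filter_upwards [hopen.mem_nhds hin] with s hs
  rw [(hZ.2.2 s hs).2, (hW.2.2 s hs).2]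

/-- The spectral zeta function of `ℝ^d / A ℤ^d`. -/
def spectralZeta {d : ℕ} (A : Matrix (Fin d) (Fin d) ℝ) : ℂ → ℂ :=
  Classical.epsilon (IsSpectralZeta A)

/-- The zeta-regularized log-determinant of the Laplacian of `ℝ^d / A ℤ^d`. -/
def logDetStar {d : ℕ} (A : Matrix (Fin d) (Fin d) ℝ) : ℂ := -deriv (spectralZeta A) 0

end RealTorus

end

/-! Frullani's formula `log Λ = ∫ (e^{-t} - e^{-Λt}) dt/t`, summed over the `V - 1` nonzero
eigenvalues, turns the log-determinant into an integral of the theta function. Splitting off `V`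
times the diagonal heat kernel of `ℤ^d` gives an exact identity, `log det* = V 𝓘_d(0) + 𝓗_N(0)`
(`log_detStar_eq`), so only `𝓗_N(0)` needs asymptotics.

Put `t = u² s`. A second use of Frullani replaces the cut-off `e^{-u² s}` by `e^{-s}` and produces
the term `log u²` (`remTerm_eq`). The remaining integral converges by dominated convergence.
Pointwise, the theta function of each discrete circle tends to a Gaussian theta function
(`tendsto_circleTheta`), and the diagonal heat kernel of `ℤ`, times the length of the circle, tends
to that of `ℝ` (`tendsto_mul_returnProb`, from the local limit theorem).

Both ends need bounds uniform in `u`. For `s > 1`, each circle theta function lies below a Gaussian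
one, whose product tends to `1` exponentially. For `s ≤ 1`, theta inversion on the circle
(`hasSum_circleTheta`) writes the theta function as a sum of Bessel terms; removing the zeroth term
leaves a difference that is small to any order in `s`, by the polynomial off-diagonal decay in
`exp_mul_besselI_le`.

Finally the limit integral is `ζ'(0)`. Riemann's method, with the functional equation of the theta
function, continues `ζ` and expresses `ζ'(0)` through an entire Mellin transform at `0` and explicit
constants. The Euler–Mascheroni constant contributed by `1/Γ` is exactly what the cut-off `e^{-s}`
absorbs (`deriv_spectralZeta_eq_integral`). -/

noncomputable section

/-! ### Spectrum of the discrete torus. -/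

namespace DiscreteTorus

/-- The eigenvalue of the Laplacian on the discrete circle `ℤ/n` that belongs to the character
`x ↦ exp (2 π i k x / n)`. -/
def circleEigenvalue (n : ℕ) (k : ZMod n) : ℝ := 2 - 2 * Real.cos (2 * Real.pi * k.val / n)

lemma circleEigenvalue_eq (n : ℕ) [NeZero n] (k : ZMod n) :
    (circleEigenvalue n k : ℂ) = 2 - (ZMod.stdAddChar k + ZMod.stdAddChar (-k)) := by
  have h1 : (ZMod.stdAddChar k : ℂ) =
      Complex.exp (((2 * Real.pi * k.val / n : ℝ) : ℂ) * Complex.I) := by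
    rw [ZMod.stdAddChar_apply, ZMod.toCircle_apply]
    congr 1
    push_cast; ring
  have h2 : (ZMod.stdAddChar (-k) : ℂ) =
      Complex.exp (-((2 * Real.pi * k.val / n : ℝ) : ℂ) * Complex.I) := by
    rw [AddChar.map_neg_eq_inv, h1, ← Complex.exp_neg]
    congr 1; ring
  rw [h1, h2, ← Complex.two_cos, circleEigenvalue]
  push_cast; ring

/-- The characters of the discrete torus. -/
def character {d : ℕ} (N : Fin d → ℕ+) (k : Vertex N) : AddChar (Vertex N) ℂ where
  toFun x := ∏ j, ZMod.stdAddChar (k j * x j)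
  map_zero_eq_one' := by simp
  map_add_eq_mul' x y := by simp [mul_add, AddChar.map_add_eq_mul, Finset.prod_mul_distrib]

lemma character_apply {d : ℕ} (N : Fin d → ℕ+) (k x : Vertex N) :
    character N k x = ∏ j, ZMod.stdAddChar (k j * x j) := rfl

lemma character_single {d : ℕ} (N : Fin d → ℕ+) (k : Vertex N) (j : Fin d)
    (c : ZMod (N j : ℕ)) : character N k (Pi.single j c) = ZMod.stdAddChar (k j * c) := by
  rw [character_apply, Finset.prod_eq_single j]
  · simp
  · intro i _ hi
    simp [Pi.single_eq_of_ne hi]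
  · simp

lemma character_injective {d : ℕ} (N : Fin d → ℕ+) : Function.Injective (character N) := by
  intro k l h
  funext j
  have := congrArg (fun ψ : AddChar (Vertex N) ℂ => ψ (Pi.single j 1)) h
  simp only [character_single, mul_one] at this
  exact ZMod.injective_stdAddChar this

/-- The basis of characters of the functions on the discrete torus. -/
def characterBasis {d : ℕ} (N : Fin d → ℕ+) : Module.Basis (Vertex N) ℂ (Vertex N → ℂ) :=
  basisOfLinearIndependentOfCardEqFinrank
    (b := fun k => (character N k : Vertex N → ℂ))
    ((AddChar.linearIndependent (Vertex N) ℂ).comp _ (character_injective N)) (by simp)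

lemma characterBasis_apply {d : ℕ} (N : Fin d → ℕ+) (k : Vertex N) :
    characterBasis N k = (character N k : Vertex N → ℂ) := by
  simp [characterBasis]

/-- The eigenvalue of the Laplacian on the discrete torus that belongs to a character. -/
def torusEigenvalue {d : ℕ} (N : Fin d → ℕ+) (k : Vertex N) : ℝ :=
  ∑ j, circleEigenvalue (N j) (k j)

/-- The Laplacian on the complex-valued functions on the discrete torus. -/
def complexLaplacian {d : ℕ} (N : Fin d → ℕ+) : (Vertex N → ℂ) →ₗ[ℂ] (Vertex N → ℂ) where
  toFun f x := ∑ j : Fin d, (2 * f x - (f (x + Pi.single j 1) + f (x - Pi.single j 1)))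
  map_add' f g := by
    funext x
    simp only [Pi.add_apply, ← Finset.sum_add_distrib]
    exact Finset.sum_congr rfl fun j _ => by ring
  map_smul' c f := by
    funext x
    simp only [Pi.smul_apply, smul_eq_mul, RingHom.id_apply, Finset.mul_sum]
    exact Finset.sum_congr rfl fun j _ => by ring

lemma complexLaplacian_character {d : ℕ} (N : Fin d → ℕ+) (k : Vertex N) :
    complexLaplacian N (character N k : Vertex N → ℂ) =
      (torusEigenvalue N k : ℂ) • (character N k : Vertex N → ℂ) := by
  funext x
  simp only [complexLaplacian, LinearMap.coe_mk, AddHom.coe_mk, Pi.smul_apply, smul_eq_mul,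
    torusEigenvalue, Complex.ofReal_sum, Finset.sum_mul]
  refine Finset.sum_congr rfl fun j _ => ?_
  rw [sub_eq_add_neg x, ← Pi.single_neg, AddChar.map_add_eq_mul, AddChar.map_add_eq_mul,
    character_single, character_single, circleEigenvalue_eq, mul_one, mul_neg_one]
  ring

lemma charpoly_complexLaplacian {d : ℕ} (N : Fin d → ℕ+) :
    (complexLaplacian N).charpoly =
      ∏ k, (Polynomial.X - Polynomial.C (torusEigenvalue N k : ℂ)) := by
  classical
  have h : LinearMap.toMatrix (characterBasis N) (characterBasis N) (complexLaplacian N) =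
      Matrix.diagonal fun k => (torusEigenvalue N k : ℂ) := by
    ext i j
    rw [LinearMap.toMatrix_apply, characterBasis_apply, complexLaplacian_character,
      ← characterBasis_apply, map_smul, Finsupp.smul_apply, Module.Basis.repr_self,
      Matrix.diagonal_apply,
      Finsupp.single_apply]
    by_cases hij : i = j
    · subst hij; simp
    · simp [hij, Ne.symm hij]
  rw [← LinearMap.charpoly_toMatrix _ (characterBasis N), h, Matrix.charpoly_diagonal]

/-- In the standard bases both operators have the same matrix. This carries the diagonalization by
complex characters back to the real operator. -/
lemma charpoly_laplacian_map {d : ℕ} (N : Fin d → ℕ+) :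
    (laplacian N).charpoly.map Complex.ofRealHom = (complexLaplacian N).charpoly := by
  classical
  rw [← LinearMap.charpoly_toMatrix (laplacian N) (Pi.basisFun ℝ (Vertex N)),
    ← LinearMap.charpoly_toMatrix (complexLaplacian N) (Pi.basisFun ℂ (Vertex N)),
    ← Matrix.charpoly_map]
  congr 1
  ext i j
  have hs (y : Vertex N) : ((Pi.single j (1 : ℝ) : Vertex N → ℝ) y : ℂ) =
      (Pi.single j (1 : ℂ) : Vertex N → ℂ) y := by
    by_cases h : y = j
    · subst h; simp
    · simp [Pi.single_eq_of_ne h]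
  simp [laplacian, complexLaplacian, hs]

theorem eigenvalues_eq {d : ℕ} (N : Fin d → ℕ+) :
    eigenvalues N = Finset.univ.val.map (torusEigenvalue N) := by
  have h : (laplacian N).charpoly =
      ∏ k, (Polynomial.X - Polynomial.C (torusEigenvalue N k)) := by
    apply Polynomial.map_injective _ Complex.ofRealHom.injective
    rw [charpoly_laplacian_map, charpoly_complexLaplacian, Polynomial.map_prod]
    simp
  rw [eigenvalues, h]
  have := Polynomial.roots_multiset_prod_X_sub_C (Finset.univ.val.map (torusEigenvalue N))
  rwa [Multiset.map_map] at this

/-- The theta function of the discrete circle. -/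
def circleTheta (n : ℕ+) (t : ℝ) : ℝ :=
  ∑ k : ZMod n, Real.exp (-circleEigenvalue n k * t)

theorem theta_eq_sum {d : ℕ} (N : Fin d → ℕ+) (t : ℝ) :
    theta N t = ∑ k, Real.exp (-torusEigenvalue N k * t) := by
  rw [theta, eigenvalues_eq, Multiset.map_map]; rfl

theorem theta_eq_prod {d : ℕ} (N : Fin d → ℕ+) (t : ℝ) :
    theta N t = ∏ j, circleTheta (N j) t := by
  simp only [theta_eq_sum, circleTheta, Finset.prod_univ_sum, Fintype.piFinset_univ]
  refine Finset.sum_congr rfl fun k _ => ?_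
  rw [← Real.exp_sum, torusEigenvalue, ← Finset.sum_neg_distrib, Finset.sum_mul]

lemma circleEigenvalue_eq_sin (n : ℕ) (k : ZMod n) :
    circleEigenvalue n k = 4 * Real.sin (Real.pi * k.val / n) ^ 2 := by
  have h := Real.cos_sq' (Real.pi * k.val / n)
  have h2 := Real.cos_two_mul (Real.pi * k.val / n)
  rw [circleEigenvalue, show 2 * Real.pi * k.val / n = 2 * (Real.pi * k.val / n) by ring]
  linarith

lemma circleEigenvalue_nonneg (n : ℕ) (k : ZMod n) : 0 ≤ circleEigenvalue n k := by
  rw [circleEigenvalue_eq_sin]; positivity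

@[simp] lemma circleEigenvalue_zero (n : ℕ) [NeZero n] : circleEigenvalue n 0 = 0 := by
  simp [circleEigenvalue]

lemma circleEigenvalue_pos {n : ℕ} [NeZero n] {k : ZMod n} (hk : k ≠ 0) :
    0 < circleEigenvalue n k := by
  rw [circleEigenvalue_eq_sin]
  have h1 : 0 < k.val := by
    rw [Nat.pos_iff_ne_zero]; simpa using hk
  have hn : (0 : ℝ) < n := by exact_mod_cast NeZero.pos n
  have h2 : (k.val : ℝ) < n := by exact_mod_cast k.val_lt
  have : 0 < Real.sin (Real.pi * k.val / n) := by
    apply Real.sin_pos_of_pos_of_lt_pi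
    · have : (0 : ℝ) < k.val := by exact_mod_cast h1
      positivity
    · rw [div_lt_iff₀ hn]
      exact mul_lt_mul_of_pos_left h2 Real.pi_pos
  positivity

/-- The kernel is one-dimensional, so dropping the zero eigenvalues from the determinant drops
exactly the trivial character. -/
lemma torusEigenvalue_pos {d : ℕ} {N : Fin d → ℕ+} {k : Vertex N} (hk : k ≠ 0) :
    0 < torusEigenvalue N k := by
  obtain ⟨j, hj⟩ := Function.ne_iff.1 hk
  exact Finset.sum_pos' (fun i _ => circleEigenvalue_nonneg _ _)
    ⟨j, Finset.mem_univ _, circleEigenvalue_pos hj⟩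

@[simp] lemma torusEigenvalue_zero {d : ℕ} (N : Fin d → ℕ+) : torusEigenvalue N 0 = 0 := by
  simp [torusEigenvalue]

theorem log_detStar {d : ℕ} (N : Fin d → ℕ+) :
    Real.log (detStar N) = ∑ k ∈ Finset.univ.erase (0 : Vertex N),
      Real.log (torusEigenvalue N k) := by
  classical
  have h : detStar N = ∏ k ∈ Finset.univ.erase (0 : Vertex N), torusEigenvalue N k := by
    rw [detStar, eigenvalues_eq, Multiset.filter_map, Finset.prod]
    congr 2
    rw [Finset.erase_val, Multiset.Nodup.erase_eq_filter _ Finset.univ.nodup]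
    refine Multiset.filter_congr fun k _ => ?_
    by_cases hk : k = 0
    · simp [hk]
    · simp [hk, (torusEigenvalue_pos hk).ne']
  rw [h, Real.log_prod]
  intro k hk
  exact (torusEigenvalue_pos (Finset.ne_of_mem_erase hk)).ne'

lemma vol_eq_card {d : ℕ} (N : Fin d → ℕ+) : vol N = Fintype.card (Vertex N) := by
  simp [vol, Fintype.card_pi, ZMod.card]

/-! ### Bessel generating function and off-diagonal decay of the heat kernel of `ℤ`. -/

/-- The pairs of natural numbers, indexed by difference and minimum. -/
def diffMinEquiv : ℤ × ℕ ≃ ℕ × ℕ where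
  toFun p := (p.2 + p.1.toNat, p.2 + (-p.1).toNat)
  invFun q := ((q.1 : ℤ) - q.2, min q.1 q.2)
  left_inv p := by ext; all_goals simp; all_goals omega
  right_inv q := by ext <;> simp <;> omega

lemma besselI_two_mul (n : ℕ) (t : ℝ) :
    besselI n (2 * t) = ∑' k : ℕ, t ^ (2 * k + n) / ((k ! : ℝ) * ((k + n)! : ℝ)) := by
  simp [besselI]

/-- In the double series of `e^{tz} e^{t/z}`, the pair of exponents with difference `x` and minimum
`k` contributes the `k`-th term of a Bessel series times `z ^ x`. -/
lemma diffMin_term (t : ℝ) {z : ℂ} (hz : z ≠ 0) (x : ℤ) (k : ℕ) :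
    (t * z) ^ (k + x.toNat) / ((k + x.toNat)! : ℂ) *
        ((t * z⁻¹) ^ (k + (-x).toNat) / ((k + (-x).toNat)! : ℂ)) =
      ((t ^ (2 * k + x.natAbs) / ((k ! : ℝ) * ((k + x.natAbs)! : ℝ)) : ℝ) : ℂ) * z ^ x := by
  obtain ⟨n, rfl | rfl⟩ := x.eq_nat_or_neg
  · have h : (z⁻¹) ^ k * z ^ k = 1 := by rw [← mul_pow, inv_mul_cancel₀ hz, one_pow]
    simp only [Int.toNat_natCast, Int.toNat_neg_natCast, Int.natAbs_natCast, zpow_natCast, add_zero]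
    push_cast
    rw [div_mul_div_comm, div_mul_eq_mul_div, mul_comm ((k + n)! : ℂ)]
    congr 1
    linear_combination (t : ℂ) ^ (2 * k + n) * z ^ n * h
  · have h : (z⁻¹) ^ k * z ^ k = 1 := by rw [← mul_pow, inv_mul_cancel₀ hz, one_pow]
    simp only [neg_neg, Int.toNat_natCast, Int.toNat_neg_natCast, Int.natAbs_neg,
      Int.natAbs_natCast, zpow_neg, zpow_natCast, add_zero, ← inv_pow]
    push_cast
    rw [div_mul_div_comm, div_mul_eq_mul_div]
    congr 1
    linear_combination (t : ℂ) ^ (2 * k + n) * z⁻¹ ^ n * h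

lemma hasSum_exp_mul_exp (t : ℝ) {z : ℂ} (hz : z ≠ 0) :
    HasSum (fun p : ℤ × ℕ => ((t ^ (2 * p.2 + p.1.natAbs) /
        ((p.2 ! : ℝ) * ((p.2 + p.1.natAbs)! : ℝ)) : ℝ) : ℂ) * z ^ p.1)
      (Complex.exp (t * (z + z⁻¹))) := by
  have h1 (w : ℂ) : HasSum (fun a : ℕ => w ^ a / (a ! : ℂ)) (Complex.exp w) := by
    rw [Complex.exp_eq_exp_ℂ]
    exact NormedSpace.expSeries_div_hasSum_exp w
  have h2 (w : ℂ) : Summable fun a : ℕ => ‖w ^ a / (a ! : ℂ)‖ :=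
    NormedSpace.norm_expSeries_div_summable w
  have hs := summable_mul_of_summable_norm (h2 (t * z)) (h2 (t * z⁻¹))
  have h3 := (h1 (t * z)).mul (h1 (t * z⁻¹)) hs
  rw [← Complex.exp_add, ← mul_add, ← diffMinEquiv.hasSum_iff] at h3
  have e : (fun p : ℤ × ℕ => ((t ^ (2 * p.2 + p.1.natAbs) /
        ((p.2 ! : ℝ) * ((p.2 + p.1.natAbs)! : ℝ)) : ℝ) : ℂ) * z ^ p.1) =
      (fun x : ℕ × ℕ => (t * z) ^ x.1 / (x.1 ! : ℂ) * ((t * z⁻¹) ^ x.2 / (x.2 ! : ℂ))) ∘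
        diffMinEquiv :=
    funext fun p => (diffMin_term t hz p.1 p.2).symm
  rw [e]
  exact h3

lemma summable_besselI (n : ℕ) (t : ℝ) :
    Summable fun k : ℕ => t ^ (2 * k + n) / ((k ! : ℝ) * ((k + n)! : ℝ)) := by
  have h := (hasSum_exp_mul_exp t one_ne_zero).summable.prod_factor (n : ℤ)
  simp only [one_zpow, mul_one, Int.natAbs_natCast] at h
  exact_mod_cast h

/-- The generating function of the modified Bessel functions of integral order. -/
theorem hasSum_besselI (t : ℝ) {z : ℂ} (hz : z ≠ 0) :
    HasSum (fun x : ℤ => (besselI x.natAbs (2 * t) : ℂ) * z ^ x)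
      (Complex.exp (t * (z + z⁻¹))) := by
  have h (x : ℤ) : HasSum (fun k : ℕ => ((t ^ (2 * k + x.natAbs) /
      ((k ! : ℝ) * ((k + x.natAbs)! : ℝ)) : ℝ) : ℂ) * z ^ x)
      ((besselI x.natAbs (2 * t) : ℂ) * z ^ x) := by
    rw [besselI_two_mul]
    exact (Complex.hasSum_ofReal.2 (summable_besselI x.natAbs t).hasSum).mul_right _
  exact (hasSum_exp_mul_exp t hz).prod_fiberwise h

theorem hasSum_besselI_real (t : ℝ) {z : ℝ} (hz : z ≠ 0) :
    HasSum (fun x : ℤ => besselI x.natAbs (2 * t) * z ^ x) (Real.exp (t * (z + z⁻¹))) := by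
  have := hasSum_besselI t (Complex.ofReal_ne_zero.2 hz)
  rw [← Complex.hasSum_ofReal]
  convert this using 1
  · funext x; push_cast; rfl
  · push_cast; rfl

lemma besselI_nonneg (n : ℕ) {t : ℝ} (ht : 0 ≤ t) : 0 ≤ besselI n (2 * t) := by
  rw [besselI_two_mul]
  exact tsum_nonneg fun k => by positivity

/-- The term of index `k` on the left and the term of index `k + 1` on the right carry the same
power of `t`, and the factorials compare. Hence monotonicity in steps of two. -/
lemma besselI_add_two_le (n : ℕ) {t : ℝ} (ht : 0 ≤ t) :
    besselI (n + 2) (2 * t) ≤ besselI n (2 * t) := by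
  rw [besselI_two_mul, besselI_two_mul]
  refine Summable.tsum_le_tsum_of_inj (fun k => k + 1) (add_left_injective 1)
    (fun k _ => by positivity) (fun k => ?_) (summable_besselI _ t) (summable_besselI _ t)
  rw [show 2 * (k + 1) + n = 2 * k + (n + 2) by ring]
  refine div_le_div_of_nonneg_left (by positivity) (by positivity) ?_
  rw [show k + (n + 2) = (k + 1 + n) + 1 by ring, Nat.factorial_succ k,
    Nat.factorial_succ (k + 1 + n)]
  push_cast
  have h1 : (0 : ℝ) ≤ k ! * (k + 1 + n)! := by positivity
  nlinarith [mul_nonneg h1 (Nat.cast_nonneg (α := ℝ) (n + 1))]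

lemma besselI_le_of_sub_two_mul {n i : ℕ} (hi : 2 * i ≤ n) {t : ℝ} (ht : 0 ≤ t) :
    besselI n (2 * t) ≤ besselI (n - 2 * i) (2 * t) := by
  induction i with
  | zero => simp
  | succ i ih =>
    refine (ih (by omega)).trans ?_
    rw [show n - 2 * i = n - 2 * (i + 1) + 2 by omega]
    exact besselI_add_two_le _ ht

/-- All terms of the generating function are nonnegative. Keep those of orders `n - 2i` with `i ≤ n
/ 4`: each order is at least `n / 2`, and each Bessel value is at least that of order `n`. Counting
them gains the factor `n / 4`, which later cancels the factor `n` in theta inversion. -/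
lemma besselI_mul_pow_le (n : ℕ) {t z : ℝ} (ht : 0 ≤ t) (hz : 1 ≤ z) :
    n / 4 * (besselI n (2 * t) * z ^ (n / 2)) ≤ Real.exp (t * (z + z⁻¹)) := by
  have hz0 : 0 < z := by linarith
  have h := sum_le_hasSum ((Finset.range (n / 4 + 1)).image fun i : ℕ => ((n - 2 * i : ℕ) : ℤ))
    (fun x _ => mul_nonneg (besselI_nonneg x.natAbs ht) (zpow_nonneg hz0.le x))
    (hasSum_besselI_real t hz0.ne')
  rw [Finset.sum_image] at h
  · refine le_trans ?_ h
    calc (n : ℝ) / 4 * (besselI n (2 * t) * z ^ (n / 2))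
        ≤ (n / 4 + 1 : ℕ) * (besselI n (2 * t) * z ^ (n / 2)) := by
          have := besselI_nonneg n ht
          gcongr
          have : n ≤ 4 * (n / 4 + 1) := by omega
          have : (n : ℝ) ≤ 4 * (n / 4 + 1 : ℕ) := by exact_mod_cast this
          linarith
      _ = ∑ i ∈ Finset.range (n / 4 + 1), besselI n (2 * t) * z ^ (n / 2) := by simp
      _ ≤ _ := by
          refine Finset.sum_le_sum fun i hi => ?_
          have hi' : i ≤ n / 4 := by simpa [Nat.lt_succ_iff] using hi
          rw [Int.natAbs_natCast, zpow_natCast]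
          have h1 := besselI_nonneg n ht
          have h2 := besselI_le_of_sub_two_mul (n := n) (i := i) (by omega) ht
          have : n / 2 ≤ n - 2 * i := by omega
          gcongr
          · exact h1.trans h2
  · intro i hi k hk hik
    simp at hi hk hik
    omega

/-- A bound for the heat kernel of `ℤ` with arbitrary polynomial decay. -/
theorem exp_mul_besselI_le {j n : ℕ} (hj : 0 < j) (hn : 2 * j ≤ n) {t : ℝ} (ht : 0 < t) :
    Real.exp (-(2 * t)) * besselI n (2 * t) ≤
      4 * Real.exp 1 / n * (4 * j * √t / n) ^ j := by
  have hs : 0 < √t := Real.sqrt_pos.2 ht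
  have hn0 : (0 : ℝ) < n := by exact_mod_cast (by omega : 0 < n)
  have hj0 : (0 : ℝ) < j := by exact_mod_cast hj
  -- The excess of the exponent over `2 * t` is `t (z - 1)² / z`; this `z` keeps it at most `1`,
  -- while Bernoulli's inequality makes `z ^ (n / 2)` large.
  set z : ℝ := 1 + 1 / √t with hz
  have hz1 : 1 ≤ z := by rw [hz]; have : 0 ≤ 1 / √t := by positivity
                         linarith
  have hz0 : 0 < z := by linarith
  have h1 := besselI_mul_pow_le n ht.le hz1
  have h2 : t * (z + z⁻¹) ≤ 2 * t + 1 := by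
    have e : t * (z + z⁻¹) - 2 * t = t * (z - 1) ^ 2 * z⁻¹ := by field_simp; ring
    have e2 : t * (z - 1) ^ 2 = 1 := by
      rw [hz, add_sub_cancel_left, div_pow, Real.sq_sqrt ht.le]; field_simp
    rw [e2, one_mul] at e
    have := inv_le_one_of_one_le₀ hz1
    linarith
  have h3 : (n / (4 * j * √t)) ^ j ≤ z ^ (n / 2) := by
    have hm : (n : ℝ) / (4 * j) ≤ (n / 2 / j : ℕ) := by
      rw [Nat.div_div_eq_div_mul, div_le_iff₀ (by positivity)]
      have h := Nat.lt_div_mul_add (a := n) (b := 2 * j) (by omega)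
      have h' : 1 ≤ n / (2 * j) := (Nat.one_le_div_iff (by omega)).2 hn
      have : n ≤ n / (2 * j) * (4 * j) := by nlinarith
      exact_mod_cast this
    calc (n / (4 * j * √t)) ^ j = ((n : ℝ) / (4 * j) * (1 / √t)) ^ j := by
          congr 1; field_simp
      _ ≤ (1 + (n / 2 / j : ℕ) * (1 / √t)) ^ j := by
          have : (n : ℝ) / (4 * j) * (1 / √t) ≤ (n / 2 / j : ℕ) * (1 / √t) := by gcongr
          gcongr
          linarith
      _ ≤ (z ^ (n / 2 / j)) ^ j := by
          gcongr
          refine one_add_mul_le_pow ?_ _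
          have : 0 ≤ 1 / √t := by positivity
          linarith
      _ = z ^ (n / 2 / j * j) := by rw [pow_mul]
      _ ≤ z ^ (n / 2) := pow_le_pow_right₀ hz1 (Nat.div_mul_le_self _ _)
  have hq := besselI_nonneg n ht.le
  have h4 : n / 4 * (besselI n (2 * t) * (n / (4 * j * √t)) ^ j) ≤
      Real.exp (2 * t) * Real.exp 1 := by
    rw [← Real.exp_add]
    refine le_trans ?_ (h1.trans (Real.exp_le_exp.2 h2))
    gcongr
  rw [Real.exp_neg]
  have he := Real.exp_pos (2 * t)
  have e : (4 * j * √t / n : ℝ) ^ j = ((n / (4 * j * √t)) ^ j)⁻¹ := by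
    rw [← inv_pow, inv_div]
  have hpos : (0 : ℝ) < (n / (4 * j * √t)) ^ j := by positivity
  rw [e, inv_mul_le_iff₀ he, ← mul_assoc, ← div_eq_mul_inv, le_div_iff₀ hpos]
  calc besselI n (2 * t) * (n / (4 * j * √t)) ^ j
      = 4 / n * (n / 4 * (besselI n (2 * t) * (n / (4 * j * √t)) ^ j)) := by field_simp
    _ ≤ 4 / n * (Real.exp (2 * t) * Real.exp 1) := by gcongr
    _ = _ := by ring

/-! ### Theta inversion on the discrete circle. -/

/-- The heat kernel of `ℤ` on the diagonal. -/
def returnProb (t : ℝ) : ℝ := Real.exp (-(2 * t)) * besselI 0 (2 * t)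

lemma exp_neg_circleEigenvalue_mul (n : ℕ) [NeZero n] (k : ZMod n) (t : ℝ) :
    HasSum (fun x : ℤ => ((Real.exp (-(2 * t)) * besselI x.natAbs (2 * t) : ℝ) : ℂ) *
      ZMod.stdAddChar ((x : ZMod n) * k)) ((Real.exp (-circleEigenvalue n k * t) : ℝ) : ℂ) := by
  have hz : (ZMod.stdAddChar k : ℂ) ≠ 0 := by
    intro h
    have := AddChar.map_add_eq_mul (ZMod.stdAddChar (N := n)) k (-k)
    simp [h] at this
  have h := (hasSum_besselI t hz).mul_left ((Real.exp (-(2 * t)) : ℝ) : ℂ)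
  have e : ((Real.exp (-circleEigenvalue n k * t) : ℝ) : ℂ) = ((Real.exp (-(2 * t)) : ℝ) : ℂ) *
      Complex.exp (t * (ZMod.stdAddChar k + (ZMod.stdAddChar k)⁻¹)) := by
    rw [← AddChar.map_neg_eq_inv, Complex.ofReal_exp, Complex.ofReal_exp, ← Complex.exp_add]
    congr 1
    push_cast
    rw [circleEigenvalue_eq]
    ring
  rw [e]
  refine h.congr_fun fun x => ?_
  rw [← zsmul_eq_mul, AddChar.map_zsmul_eq_zpow]
  push_cast; ring

/-- The theta inversion formula on the discrete circle. -/
theorem hasSum_circleTheta (n : ℕ+) (t : ℝ) :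
    HasSum (fun k : ℤ => n * (Real.exp (-(2 * t)) * besselI (n * k.natAbs) (2 * t)))
      (circleTheta n t) := by
  have h1 := hasSum_sum (s := Finset.univ)
    fun (k : ZMod n) _ => exp_neg_circleEigenvalue_mul n k t
  have h2 (x : ℤ) : ∑ k : ZMod n, ((Real.exp (-(2 * t)) * besselI x.natAbs (2 * t) : ℝ) : ℂ) *
      ZMod.stdAddChar ((x : ZMod n) * k) =
      ((if (x : ZMod n) = 0 then n * (Real.exp (-(2 * t)) * besselI x.natAbs (2 * t)) else 0 : ℝ) :
        ℂ) := by
    rw [← Finset.mul_sum]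
    simp_rw [mul_comm (x : ZMod n)]
    -- Orthogonality of characters keeps only the multiples of `n`.
    rw [AddChar.sum_mulShift _ (ZMod.isPrimitive_stdAddChar n), ZMod.card]
    split_ifs
    · push_cast; ring
    · simp
  simp_rw [h2, ← Complex.ofReal_sum] at h1
  rw [Complex.hasSum_ofReal] at h1
  have hn : (n : ℤ) ≠ 0 := by exact_mod_cast n.pos.ne'
  have hinj : Function.Injective fun k : ℤ => (n : ℤ) * k := mul_right_injective₀ hn
  have h3 := (hinj.hasSum_iff (a := circleTheta n t) ?_).2 h1
  · convert h3 using 1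
    funext k
    simp [Int.natAbs_mul]
  · intro x hx
    rw [if_neg]
    intro h
    rw [ZMod.intCast_zmod_eq_zero_iff_dvd] at h
    obtain ⟨c, rfl⟩ := h
    exact hx ⟨c, rfl⟩

theorem mul_returnProb_le_circleTheta (n : ℕ+) {t : ℝ} (ht : 0 ≤ t) :
    n * returnProb t ≤ circleTheta n t := by
  have := le_hasSum (hasSum_circleTheta n t) 0 fun k _ =>
    mul_nonneg (Nat.cast_nonneg _) (mul_nonneg (Real.exp_pos _).le (besselI_nonneg _ ht))
  simpa [returnProb] using this

/-- The difference between the theta function of the discrete circle and its leading term decays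
faster than any power of the time. -/
theorem exists_circleTheta_sub_le {j : ℕ} (hj : 0 < j) :
    ∃ C : ℝ, 0 ≤ C ∧ ∀ (n : ℕ+) (t : ℝ), 2 * j ≤ (n : ℕ) → 0 < t →
      circleTheta n t - n * returnProb t ≤ C * (√t / n) ^ j := by
  have hsum : Summable fun k : ℤ => 1 / (k : ℝ) ^ 2 :=
    (Real.summable_one_div_int_pow (p := 2)).2 one_lt_two
  refine ⟨4 * Real.exp 1 * (4 * j) ^ j * ∑' k : ℤ, 1 / (k : ℝ) ^ 2, by positivity, ?_⟩
  intro n t hn ht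
  have hn0 : (0 : ℝ) < (n : ℕ) := by exact_mod_cast n.pos
  have h1 : HasSum (fun k : ℤ => if k = 0 then n * returnProb t else 0) (n * returnProb t) :=
    hasSum_ite_eq 0 _
  have h2 := h1.add (hsum.hasSum.mul_left (4 * Real.exp 1 * (4 * j) ^ j * (√t / n) ^ j))
  have h3 := hasSum_le (fun k => ?_) (hasSum_circleTheta n t) h2
  · calc circleTheta n t - n * returnProb t
      ≤ 4 * Real.exp 1 * (4 * j) ^ j * (√t / n) ^ j * ∑' k : ℤ, 1 / (k : ℝ) ^ 2 := by linarith
    _ = _ := by ring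
  · rcases eq_or_ne k 0 with rfl | hk
    · simp [returnProb]
    · have hk1 : 1 ≤ k.natAbs := Int.natAbs_pos.2 hk
      have hk1' : (1 : ℝ) ≤ k.natAbs := by exact_mod_cast hk1
      have hk2 : (k : ℝ) ^ 2 = (k.natAbs : ℝ) ^ 2 := by
        rw [← Int.cast_natCast, Int.natCast_natAbs, Int.cast_abs, sq_abs]
      have hb := exp_mul_besselI_le (n := n * k.natAbs) hj (by nlinarith) ht
      rw [if_neg hk, zero_add, hk2]
      refine (mul_le_mul_of_nonneg_left hb hn0.le).trans ?_
      push_cast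
      -- One factor `1 / |k|` comes from the prefactor of the Bessel bound and `j ≥ 1` more from its
      -- power, so the sum over `k` converges.
      have hp : (k.natAbs : ℝ) ^ 2 ≤ k.natAbs * k.natAbs ^ j := by
        rw [sq]
        gcongr
        exact le_self_pow₀ hk1' hj.ne'
      calc (n : ℝ) * (4 * Real.exp 1 / (n * k.natAbs) * (4 * j * √t / (n * k.natAbs)) ^ j)
          = 4 * Real.exp 1 * (4 * j) ^ j * (√t / n) ^ j *
            (1 / (k.natAbs * k.natAbs ^ j)) := by
              rw [show 4 * j * √t / (n * k.natAbs) = 4 * j * (√t / n) * (1 / k.natAbs) by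
                field_simp, mul_pow, mul_pow, one_div_pow]
              field_simp
        _ ≤ _ := by gcongr

/-! ### The diagonal heat kernel of `ℤ`: bounds and local limit theorem. -/

lemma returnProb_nonneg {t : ℝ} (ht : 0 ≤ t) : 0 ≤ returnProb t :=
  mul_nonneg (Real.exp_pos _).le (besselI_nonneg _ ht)

lemma returnProb_le_one {t : ℝ} (ht : 0 ≤ t) : returnProb t ≤ 1 := by
  have h := le_hasSum (hasSum_besselI_real t one_ne_zero) 0 fun x _ => by
    simpa using besselI_nonneg _ ht
  simp only [Int.natAbs_zero, zpow_zero, mul_one, inv_one] at h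
  rw [one_add_one_eq_two, mul_comm t] at h
  rwa [returnProb, Real.exp_neg, inv_mul_le_iff₀ (Real.exp_pos _), mul_one]

lemma one_sub_le_returnProb {t : ℝ} (ht : 0 ≤ t) : 1 - 2 * t ≤ returnProb t := by
  have h1 : 1 ≤ besselI 0 (2 * t) := by
    rw [besselI_two_mul]
    have := (summable_besselI 0 t).le_tsum 0 fun k _ => by positivity
    simpa using this
  have h2 := Real.add_one_le_exp (-(2 * t))
  have h3 := Real.exp_pos (-(2 * t))
  rw [returnProb]
  nlinarith

lemma integral_exp_int_mul_I {x : ℤ} (hx : x ≠ 0) :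
    ∫ θ in -Real.pi..Real.pi, Complex.exp (θ * Complex.I) ^ x = 0 := by
  have hc : (x * Complex.I : ℂ) ≠ 0 := by simp [hx]
  have h : (fun θ : ℝ => Complex.exp (θ * Complex.I) ^ x) =
      fun θ : ℝ => Complex.exp (x * Complex.I * θ) := by
    funext θ
    rw [← Complex.exp_int_mul]
    congr 1; ring
  rw [h, integral_exp_mul_complex hc, div_eq_zero_iff]
  left
  rw [sub_eq_zero, Complex.exp_eq_exp_iff_exists_int]
  exact ⟨x, by push_cast; ring⟩

/-- The heat kernel of `ℤ` as a Fourier integral. -/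
theorem returnProb_eq_integral {t : ℝ} (ht : 0 ≤ t) :
    returnProb t =
      (2 * Real.pi)⁻¹ * ∫ θ in -Real.pi..Real.pi, Real.exp (-(2 * t * (1 - Real.cos θ))) := by
  have hs := hasSum_besselI_real t one_ne_zero
  simp only [one_zpow, mul_one] at hs
  have h1 := intervalIntegral.hasSum_integral_of_dominated_convergence (μ := volume)
    (a := -Real.pi) (b := Real.pi)
    (F := fun (x : ℤ) (θ : ℝ) => (besselI x.natAbs (2 * t) : ℂ) * Complex.exp (θ * Complex.I) ^ x)
    (f := fun θ : ℝ => Complex.exp (t * (Complex.exp (θ * Complex.I) +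
      (Complex.exp (θ * Complex.I))⁻¹)))
    (bound := fun x _ => besselI x.natAbs (2 * t))
    (fun x => by
      refine Continuous.aestronglyMeasurable ?_
      simp_rw [← Complex.exp_int_mul]
      fun_prop)
    (fun x => ae_of_all _ fun θ _ => by
      rw [norm_mul, norm_zpow, Complex.norm_exp_ofReal_mul_I, one_zpow, mul_one, Complex.norm_real,
        Real.norm_of_nonneg (besselI_nonneg _ ht)])
    (ae_of_all _ fun θ _ => hs.summable)
    (by simp)
    (ae_of_all _ fun θ _ => hasSum_besselI t (Complex.exp_ne_zero _))
  have h2 := hasSum_single (f := fun x : ℤ => ∫ θ in -Real.pi..Real.pi,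
    (besselI x.natAbs (2 * t) : ℂ) * Complex.exp (θ * Complex.I) ^ x) 0 (fun x hx => by
      rw [intervalIntegral.integral_const_mul, integral_exp_int_mul_I hx, mul_zero])
  have h3 := h1.unique h2
  have h4 (θ : ℝ) : Complex.exp (t * (Complex.exp (θ * Complex.I) +
      (Complex.exp (θ * Complex.I))⁻¹)) = ((Real.exp (2 * t) *
        Real.exp (-(2 * t * (1 - Real.cos θ))) : ℝ) : ℂ) := by
    rw [← Complex.exp_neg, ← neg_mul, ← Complex.two_cos, ← Real.exp_add]
    push_cast
    congr 1; ring
  simp only [h4, Int.natAbs_zero, zpow_zero, mul_one, intervalIntegral.integral_const,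
    sub_neg_eq_add, intervalIntegral.integral_ofReal, intervalIntegral.integral_const_mul,
    Complex.real_smul, ← Complex.ofReal_mul, Complex.ofReal_inj] at h3
  rw [returnProb, Real.exp_neg]
  have := Real.exp_pos (2 * t)
  have := Real.pi_pos
  field_simp
  linarith

lemma continuousOn_returnProb : ContinuousOn returnProb (Ici 0) := by
  have h : Continuous fun t : ℝ => (2 * Real.pi)⁻¹ *
      ∫ θ in -Real.pi..Real.pi, Real.exp (-(2 * t * (1 - Real.cos θ))) := by
    refine continuous_const.mul ?_
    apply intervalIntegral.continuous_parametric_intervalIntegral_of_continuous'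
    fun_prop
  exact h.continuousOn.congr fun t ht => returnProb_eq_integral ht

lemma exp_cos_le {t θ : ℝ} (ht : 0 ≤ t) (hθ : θ ∈ Icc (-Real.pi) Real.pi) :
    Real.exp (-(2 * t * (1 - Real.cos θ))) ≤ Real.exp (-(4 / Real.pi ^ 2 * t) * θ ^ 2) := by
  have := Real.cos_le_one_sub_mul_cos_sq (abs_le.2 hθ)
  rw [Real.exp_le_exp]
  have h : 2 * t * (2 / Real.pi ^ 2 * θ ^ 2) ≤ 2 * t * (1 - Real.cos θ) := by gcongr; linarith
  calc _ ≤ -(2 * t * (2 / Real.pi ^ 2 * θ ^ 2)) := by linarith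
    _ = _ := by ring

/-- Writing `r sin x = r x · sinc x` and using continuity of `sinc` avoids any separate treatment of
`x = 0`. -/
lemma tendsto_mul_sin {ι : Type*} {l : Filter ι} {r x : ι → ℝ} {c : ℝ}
    (hx : Tendsto x l (𝓝 0)) (hrx : Tendsto (fun i => r i * x i) l (𝓝 c)) :
    Tendsto (fun i => r i * Real.sin (x i)) l (𝓝 c) := by
  have h := hrx.mul ((Real.continuous_sinc.tendsto 0).comp hx)
  rw [Real.sinc_zero, mul_one] at h
  refine h.congr fun i => ?_
  rcases eq_or_ne (x i) 0 with h0 | h0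
  · simp [h0]
  · simp only [Function.comp_apply, Real.sinc_of_ne_zero h0]
    field_simp

/-- The local limit theorem on the diagonal. -/
theorem tendsto_sqrt_mul_returnProb :
    Tendsto (fun t => √t * returnProb t) atTop (𝓝 (1 / √(4 * Real.pi))) := by
  -- The Fourier integrand after `θ = y / √t`, extended by zero to the whole line. With `1 - cos θ =
  -- 2 sin² (θ / 2)` it tends to a Gaussian.
  set g : ℝ → ℝ → ℝ := fun t => (Ioc (-Real.pi * √t) (Real.pi * √t)).indicator
    fun y => Real.exp (-(2 * t * (1 - Real.cos (y / √t)))) with hg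
  have key : Tendsto (fun t => ∫ y, g t y) atTop (𝓝 (∫ y : ℝ, Real.exp (-1 * y ^ 2))) := by
    refine tendsto_integral_filter_of_dominated_convergence
      (fun y => Real.exp (-(4 / Real.pi ^ 2) * y ^ 2)) ?_ ?_ ?_ ?_
    · filter_upwards with t
      refine AEStronglyMeasurable.indicator ?_ measurableSet_Ioc
      exact Continuous.aestronglyMeasurable (by fun_prop)
    · filter_upwards [eventually_gt_atTop 0] with t ht
      filter_upwards with y
      have hs := Real.sqrt_pos.2 ht
      simp only [hg]
      by_cases hy : y ∈ Ioc (-Real.pi * √t) (Real.pi * √t)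
      · rw [indicator_of_mem hy, Real.norm_of_nonneg (Real.exp_pos _).le]
        refine (exp_cos_le ht.le ⟨?_, ?_⟩).trans_eq ?_
        · rw [le_div_iff₀ hs]; exact hy.1.le
        · rw [div_le_iff₀ hs]; exact hy.2
        · rw [div_pow, Real.sq_sqrt ht.le]
          congr 1; field_simp
      · rw [indicator_of_notMem hy, norm_zero]
        positivity
    · exact integrable_exp_neg_mul_sq (by positivity)
    · filter_upwards with y
      have h1 : Tendsto (fun t : ℝ => 2 * √t * Real.sin (y / 2 / √t)) atTop (𝓝 y) := by
        apply tendsto_mul_sin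
        · exact tendsto_const_nhds.div_atTop Real.tendsto_sqrt_atTop
        · refine tendsto_const_nhds.congr' ?_
          filter_upwards [eventually_gt_atTop 0] with t ht
          have hs := Real.sqrt_pos.2 ht
          field_simp
      have h2 : Tendsto (fun t : ℝ => Real.exp (-1 * (2 * √t * Real.sin (y / 2 / √t)) ^ 2)) atTop
          (𝓝 (Real.exp (-1 * y ^ 2))) :=
        (Real.continuous_exp.tendsto _).comp ((h1.pow 2).const_mul (-1))
      refine h2.congr' ?_
      have h3 : ∀ᶠ t : ℝ in atTop, |y| < Real.pi * √t :=
        (Real.tendsto_sqrt_atTop.const_mul_atTop Real.pi_pos).eventually_gt_atTop _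
      filter_upwards [h3, eventually_gt_atTop 0] with t ht ht0
      rw [abs_lt] at ht
      have hy : y ∈ Ioc (-Real.pi * √t) (Real.pi * √t) := ⟨by linarith, ht.2.le⟩
      simp only [hg, indicator_of_mem hy]
      congr 1
      have h4 := Real.cos_sq' (y / 2 / √t)
      have h5 := Real.cos_two_mul (y / 2 / √t)
      rw [show 2 * (y / 2 / √t) = y / √t by ring] at h5
      rw [h5, h4, mul_pow, mul_pow, Real.sq_sqrt ht0.le]
      ring
  rw [integral_gaussian] at key
  have h := key.const_mul (2 * Real.pi)⁻¹
  have e : (2 * Real.pi)⁻¹ * √(Real.pi / 1) = 1 / √(4 * Real.pi) := by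
    rw [div_one, Real.sqrt_mul (by norm_num), show (4 : ℝ) = 2 ^ 2 by norm_num,
      Real.sqrt_sq (by norm_num)]
    have := Real.sqrt_pos.2 Real.pi_pos
    field_simp
    rw [Real.sq_sqrt Real.pi_pos.le]
  rw [e] at h
  refine h.congr' ?_
  filter_upwards [eventually_gt_atTop 0] with t ht
  have hs := Real.sqrt_pos.2 ht
  rw [hg, integral_indicator measurableSet_Ioc,
    ← intervalIntegral.integral_of_le (by nlinarith [Real.pi_pos]),
    returnProb_eq_integral ht.le]
  have := intervalIntegral.integral_comp_div (a := -Real.pi * √t) (b := Real.pi * √t)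
    (fun y => Real.exp (-(2 * t * (1 - Real.cos y)))) hs.ne'
  rw [this, mul_div_cancel_right₀ _ hs.ne', mul_div_cancel_right₀ _ hs.ne', smul_eq_mul]
  ring

theorem returnProb_le_inv_sqrt {t : ℝ} (ht : 0 < t) : returnProb t ≤ 1 / √t := by
  have hb : 0 < 4 / Real.pi ^ 2 * t := by positivity
  have hpi := Real.pi_pos
  have h1 : ∫ θ in -Real.pi..Real.pi, Real.exp (-(2 * t * (1 - Real.cos θ))) ≤
      √(Real.pi / (4 / Real.pi ^ 2 * t)) := by
    rw [← integral_gaussian]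
    calc _ ≤ ∫ θ in -Real.pi..Real.pi, Real.exp (-(4 / Real.pi ^ 2 * t) * θ ^ 2) := by
          refine intervalIntegral.integral_mono_on (by linarith)
            (Continuous.intervalIntegrable (by fun_prop) _ _)
            (Continuous.intervalIntegrable (by fun_prop) _ _) fun θ hθ => exp_cos_le ht.le hθ
      _ ≤ _ := by
          rw [intervalIntegral.integral_of_le (by linarith)]
          exact setIntegral_le_integral (integrable_exp_neg_mul_sq hb)
            (ae_of_all _ fun _ => (Real.exp_pos _).le)
  rw [returnProb_eq_integral ht.le]
  have h2 : √(Real.pi / (4 / Real.pi ^ 2 * t)) ≤ 2 * Real.pi * (1 / √t) := by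
    rw [Real.sqrt_le_left (by positivity), mul_pow, div_pow, Real.sq_sqrt ht.le]
    have e : Real.pi / (4 / Real.pi ^ 2 * t) = Real.pi ^ 2 / t * (Real.pi / 4) := by field_simp
    rw [e, show (2 * Real.pi) ^ 2 * (1 ^ 2 / t) = Real.pi ^ 2 / t * 4 by ring]
    gcongr
    linarith [Real.pi_le_four]
  calc _ ≤ (2 * Real.pi)⁻¹ * (2 * Real.pi * (1 / √t)) := by
        gcongr
        exact h1.trans h2
    _ = 1 / √t := by field_simp

end DiscreteTorus

/-! ### Gaussian theta functions. -/

/-- The Gaussian theta function `∑ exp (-y m²)`, the sum being over the integers. -/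
def gaussTheta (y : ℝ) : ℝ := ∑' m : ℤ, Real.exp (-(y * (m : ℝ) ^ 2))

lemma summable_gaussTheta {y : ℝ} (hy : 0 < y) :
    Summable fun m : ℤ => Real.exp (-(y * (m : ℝ) ^ 2)) := by
  have h : Summable fun n : ℕ => Real.exp (-(y * (n : ℝ) ^ 2)) := by
    refine Summable.of_nonneg_of_le (fun _ => (Real.exp_pos _).le) (fun n => ?_)
      (summable_geometric_of_lt_one (Real.exp_pos (-y)).le (by simpa using hy))
    rw [← Real.exp_nat_mul, Real.exp_le_exp]
    have : (n : ℝ) ≤ (n : ℝ) ^ 2 := by exact_mod_cast Nat.le_self_pow two_ne_zero n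
    nlinarith
  exact Summable.of_nat_of_neg (by simpa using h) (by simpa using h)

lemma one_le_gaussTheta {y : ℝ} (hy : 0 < y) : 1 ≤ gaussTheta y := by
  have := (summable_gaussTheta hy).le_tsum 0 fun m _ => (Real.exp_pos _).le
  simpa [gaussTheta] using this

lemma gaussTheta_le_of_le {a b : ℝ} (ha : 0 < a) (hab : a ≤ b) : gaussTheta b ≤ gaussTheta a :=
  (summable_gaussTheta (ha.trans_le hab)).tsum_le_tsum
    (fun m => Real.exp_le_exp.2 (by gcongr)) (summable_gaussTheta ha)

lemma continuousOn_gaussTheta : ContinuousOn gaussTheta (Ioi 0) := by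
  intro y (hy : 0 < y)
  have h : ContinuousOn gaussTheta (Ici (y / 2)) := by
    refine continuousOn_tsum (fun m => by fun_prop) (summable_gaussTheta (half_pos hy))
      fun m x (hx : y / 2 ≤ x) => ?_
    rw [Real.norm_of_nonneg (Real.exp_pos _).le]
    gcongr
  exact (h.continuousAt (Ici_mem_nhds (by linarith))).continuousWithinAt

/-- The functional equation of the Gaussian theta function. -/
lemma gaussTheta_inv {y : ℝ} (hy : 0 < y) :
    gaussTheta y = √(Real.pi / y) * gaussTheta (Real.pi ^ 2 / y) := by
  have h := Real.tsum_exp_neg_mul_int_sq (a := y / Real.pi) (by positivity)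
  have hpi := Real.pi_pos
  rw [← Real.sqrt_eq_rpow, one_div, ← Real.sqrt_inv, inv_div] at h
  rw [gaussTheta, gaussTheta]
  convert h using 5
  · field_simp
  · field_simp

/-- For `m ≠ 0`, `c s m² ≥ c (s - 1) + c m²`, so a factor `e^{-c(s-1)}` comes out of every
nonconstant term. -/
lemma gaussTheta_mul_le {c : ℝ} (hc : 0 < c) {s : ℝ} (hs : 1 ≤ s) :
    gaussTheta (c * s) ≤ 1 + Real.exp c * gaussTheta c * Real.exp (-(c * s)) := by
  have h1 : HasSum (fun m : ℤ => if m = 0 then (1 : ℝ) else 0) 1 := hasSum_ite_eq 0 _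
  have h2 := h1.add ((summable_gaussTheta hc).hasSum.mul_left (Real.exp (-(c * (s - 1)))))
  have h3 := hasSum_le (fun m : ℤ => ?_)
    (summable_gaussTheta (y := c * s) (by positivity)).hasSum h2
  · refine h3.trans_eq ?_
    rw [← gaussTheta, mul_right_comm, ← Real.exp_add]
    ring_nf
  · rcases eq_or_ne m 0 with rfl | hm
    · simp [(Real.exp_pos _).le]
    · rw [if_neg hm, zero_add, ← Real.exp_add, Real.exp_le_exp]
      have hm1 : (1 : ℝ) ≤ (m : ℝ) ^ 2 := by
        have : 0 < m ^ 2 := by positivity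
        exact_mod_cast (by omega : 1 ≤ m ^ 2)
      have : 0 ≤ c * (s - 1) := mul_nonneg hc.le (by linarith)
      nlinarith

lemma one_le_prod_gaussTheta {ι : Type*} (S : Finset ι) {c : ι → ℝ} (hc : ∀ j, 0 < c j) {s : ℝ}
    (hs : 0 < s) : 1 ≤ ∏ j ∈ S, gaussTheta (c j * s) :=
  Finset.prod_induction _ (1 ≤ ·) (fun _ _ => one_le_mul_of_one_le_of_one_le) le_rfl
    fun j _ => one_le_gaussTheta (mul_pos (hc j) hs)

/-- Products of Gaussian theta functions converge exponentially fast to `1`. -/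
lemma exists_prod_gaussTheta_le {ι : Type*} (S : Finset ι) {c : ι → ℝ} (hc : ∀ j, 0 < c j) :
    ∃ K a : ℝ, 0 < K ∧ 0 < a ∧ ∀ s : ℝ, 1 ≤ s →
      ∏ j ∈ S, gaussTheta (c j * s) ≤ 1 + K * Real.exp (-a * s) := by
  classical
  induction S using Finset.induction_on with
  | empty => exact ⟨1, 1, one_pos, one_pos, fun s _ => by simp [(Real.exp_pos _).le]⟩
  | insert i S hi ih =>
    obtain ⟨K, a, hK, ha, h⟩ := ih
    set L := Real.exp (c i) * gaussTheta (c i) with hL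
    have hL0 : 0 < L := mul_pos (Real.exp_pos _) (one_pos.trans_le (one_le_gaussTheta (hc i)))
    -- These are the coefficients of `(1 + L x)(1 + K x)`, with `x² ≤ x` for the common exponential
    -- `x ≤ 1`.
    refine ⟨L + K + L * K, min (c i) a, by positivity, lt_min (hc i) ha, fun s hs => ?_⟩
    rw [Finset.prod_insert hi]
    set x := Real.exp (-min (c i) a * s) with hx
    have hx0 : 0 < x := Real.exp_pos _
    have hmin := lt_min (hc i) ha
    have hx1 : x ≤ 1 := Real.exp_le_one_iff.2 (by nlinarith)
    have h1 : gaussTheta (c i * s) ≤ 1 + L * x := by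
      refine (gaussTheta_mul_le (hc i) hs).trans ?_
      have : Real.exp (-(c i * s)) ≤ x :=
        Real.exp_le_exp.2 (by nlinarith [min_le_left (c i) a])
      gcongr
    have h2 : ∏ j ∈ S, gaussTheta (c j * s) ≤ 1 + K * x := by
      refine (h s hs).trans ?_
      have : Real.exp (-a * s) ≤ x :=
        Real.exp_le_exp.2 (by nlinarith [min_le_right (c i) a])
      gcongr
    have h0 : 0 ≤ ∏ j ∈ S, gaussTheta (c j * s) :=
      zero_le_one.trans (one_le_prod_gaussTheta S hc (by linarith))
    calc _ ≤ (1 + L * x) * (1 + K * x) := by gcongr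
      _ = 1 + (L + K) * x + L * K * (x * x) := by ring
      _ ≤ 1 + (L + K) * x + L * K * (1 * x) := by gcongr
      _ = _ := by ring

lemma isBigO_prod_gaussTheta_sub_one {ι : Type*} (S : Finset ι) {c : ι → ℝ} (hc : ∀ j, 0 < c j)
    (r : ℝ) : (fun s : ℝ => ∏ j ∈ S, gaussTheta (c j * s) - 1) =O[atTop] (· ^ r) := by
  obtain ⟨K, a, hK, ha, h⟩ := exists_prod_gaussTheta_le S hc
  refine IsBigO.trans ?_ (isLittleO_exp_neg_mul_rpow_atTop ha r).isBigO
  refine IsBigO.of_bound K ?_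
  filter_upwards [eventually_ge_atTop 1] with s hs
  rw [Real.norm_of_nonneg (Real.exp_pos _).le, Real.norm_of_nonneg]
  · linarith [h s hs]
  · linarith [one_le_prod_gaussTheta S hc (by linarith : 0 < s)]

lemma continuousOn_prod_gaussTheta {ι : Type*} (S : Finset ι) {c : ι → ℝ} (hc : ∀ j, 0 < c j) :
    ContinuousOn (fun s : ℝ => ∏ j ∈ S, gaussTheta (c j * s)) (Ioi 0) :=
  continuousOn_finsetProd _ fun j _ =>
    continuousOn_gaussTheta.comp (by fun_prop) fun _ hs => mul_pos (hc j) hs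

/-! ### Scaling limit of the theta functions of discrete circles. -/

namespace DiscreteTorus

/-- The representatives of the residue classes mod `n` of least absolute value. -/
def leastResidues (n : ℕ) : Set ℤ := {m | m * 2 ∈ Ioc (-n : ℤ) n}

lemma range_valMinAbs (n : ℕ) [NeZero n] : range (ZMod.valMinAbs (n := n)) = leastResidues n := by
  ext m
  constructor
  · rintro ⟨x, rfl⟩
    exact x.valMinAbs_mem_Ioc
  · intro hm
    exact ⟨m, (ZMod.valMinAbs_spec _ _).2 ⟨rfl, hm⟩⟩

lemma circleEigenvalue_eq_valMinAbs (n : ℕ) [NeZero n] (k : ZMod n) :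
    circleEigenvalue n k = 2 - 2 * Real.cos (2 * Real.pi * k.valMinAbs / n) := by
  have hn : (n : ℝ) ≠ 0 := NeZero.ne _
  rw [circleEigenvalue, ZMod.valMinAbs_def_pos]
  split_ifs
  · simp
  · push_cast
    rw [show 2 * Real.pi * ((k.val : ℝ) - n) / n = 2 * Real.pi * k.val / n - 2 * Real.pi by
      field_simp, Real.cos_sub_two_pi]

lemma circleTheta_eq_tsum (n : ℕ+) (t : ℝ) :
    circleTheta n t = ∑' m : ℤ, (leastResidues n).indicator
      (fun m : ℤ => Real.exp (-(2 - 2 * Real.cos (2 * Real.pi * m / n)) * t)) m := by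
  have h := (ZMod.injective_valMinAbs (n := n)).tsum_eq (f := (leastResidues n).indicator
      (fun m : ℤ => Real.exp (-(2 - 2 * Real.cos (2 * Real.pi * m / n)) * t)))
    (by rw [range_valMinAbs]; exact support_indicator_subset)
  rw [← h, tsum_fintype, circleTheta]
  refine Finset.sum_congr rfl fun k _ => ?_
  rw [indicator_of_mem (by rw [← range_valMinAbs]; exact mem_range_self k),
    circleEigenvalue_eq_valMinAbs]

lemma one_le_circleTheta (n : ℕ+) (t : ℝ) : 1 ≤ circleTheta n t := by
  have := Finset.single_le_sum (f := fun k : ZMod n => Real.exp (-circleEigenvalue n k * t))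
    (fun k _ => (Real.exp_pos _).le) (Finset.mem_univ 0)
  simpa [circleTheta] using this

/-- For least residues the angle `2πm/n` lies in `[-π, π]`, where `1 - cos x ≥ 2x²/π²`; this gives
eigenvalues at least `16 m²/n²`. Besides bounding the theta function, it is the summable majorant
for the termwise limit. -/
lemma indicator_le_gauss (n : ℕ+) {t : ℝ} (ht : 0 ≤ t) (m : ℤ) :
    (leastResidues n).indicator
      (fun m : ℤ => Real.exp (-(2 - 2 * Real.cos (2 * Real.pi * m / n)) * t)) m ≤
      Real.exp (-(16 * t / n ^ 2 * (m : ℝ) ^ 2)) := by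
  refine indicator_apply_le' (fun hm => ?_) (fun _ => (Real.exp_pos _).le)
  have hn : (0 : ℝ) < n := by exact_mod_cast n.pos
  have hm' : |(m : ℝ)| * 2 ≤ n := by
    have h1 : |m * 2| ≤ (n : ℤ) := abs_le.2 ⟨hm.1.le, hm.2⟩
    rw [abs_mul, abs_two] at h1
    exact_mod_cast h1
  have hx : |2 * Real.pi * m / n| ≤ Real.pi := by
    rw [abs_div, abs_mul, abs_of_pos hn, abs_of_pos Real.two_pi_pos, div_le_iff₀ hn]
    nlinarith [Real.pi_pos]
  have h := Real.cos_le_one_sub_mul_cos_sq hx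
  rw [Real.exp_le_exp]
  have e : 2 * (2 / Real.pi ^ 2 * (2 * Real.pi * m / n) ^ 2) = 16 / n ^ 2 * (m : ℝ) ^ 2 := by
    field_simp; ring
  have h2 : 16 / n ^ 2 * (m : ℝ) ^ 2 ≤ 2 - 2 * Real.cos (2 * Real.pi * m / n) := by
    rw [← e]; linarith
  calc _ ≤ -(16 / n ^ 2 * (m : ℝ) ^ 2) * t := by gcongr
    _ = _ := by ring

lemma circleTheta_le_gaussTheta (n : ℕ+) {t : ℝ} (ht : 0 < t) :
    circleTheta n t ≤ gaussTheta (16 * t / n ^ 2) := by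
  have hn : (0 : ℝ) < n := by exact_mod_cast n.pos
  have hs := summable_gaussTheta (y := 16 * t / n ^ 2) (by positivity)
  rw [circleTheta_eq_tsum]
  refine Summable.tsum_le_tsum (indicator_le_gauss n ht.le) ?_ hs
  exact Summable.of_nonneg_of_le (fun m => indicator_nonneg (fun _ _ => (Real.exp_pos _).le) m)
    (indicator_le_gauss n ht.le) hs

section Limit

variable {n : ℕ → ℕ+} {α : ℝ}

lemma eventually_le_mul (hα : 0 < α)
    (hn : Tendsto (fun u : ℕ => ((n u : ℕ) : ℝ) / (u : ℝ)) atTop (𝓝 α)) :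
    ∀ᶠ u : ℕ in atTop, 0 < (u : ℝ) ∧ α / 2 * u ≤ n u ∧ (n u : ℝ) ≤ 2 * α * u := by
  filter_upwards [eventually_gt_atTop 0, hn.eventually_const_lt (half_lt_self hα),
    hn.eventually_lt_const (by linarith : α < 2 * α)] with u hu h1 h2
  have hu' : (0 : ℝ) < u := by exact_mod_cast hu
  exact ⟨hu', ((lt_div_iff₀ hu').1 h1).le, ((div_lt_iff₀ hu').1 h2).le⟩

lemma eventually_le_sixteen_mul_div (hα : 0 < α)
    (hn : Tendsto (fun u : ℕ => ((n u : ℕ) : ℝ) / (u : ℝ)) atTop (𝓝 α)) :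
    ∀ᶠ u : ℕ in atTop, ∀ s : ℝ, 0 ≤ s → 4 / α ^ 2 * s ≤ 16 * ((u : ℝ) ^ 2 * s) / (n u) ^ 2 := by
  filter_upwards [eventually_le_mul hα hn] with u ⟨hu, _, h2⟩ s hs
  have hn : (0 : ℝ) < n u := by exact_mod_cast (n u).pos
  rw [le_div_iff₀ (by positivity)]
  calc 4 / α ^ 2 * s * (n u : ℝ) ^ 2 ≤ 4 / α ^ 2 * s * (2 * α * u) ^ 2 := by gcongr
    _ = _ := by field_simp; ring

lemma eventually_circleTheta_le (hα : 0 < α)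
    (hn : Tendsto (fun u : ℕ => ((n u : ℕ) : ℝ) / (u : ℝ)) atTop (𝓝 α)) :
    ∀ᶠ u : ℕ in atTop, ∀ s : ℝ, 0 < s →
      circleTheta (n u) ((u : ℝ) ^ 2 * s) ≤ gaussTheta (4 / α ^ 2 * s) := by
  filter_upwards [eventually_le_mul hα hn, eventually_le_sixteen_mul_div hα hn]
    with u ⟨hu, _, _⟩ h2 s hs
  exact (circleTheta_le_gaussTheta _ (by positivity)).trans
    (gaussTheta_le_of_le (by positivity) (h2 s hs.le))

/-- The theta functions of discrete circles converge to that of the circle. -/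
theorem tendsto_circleTheta (hα : 0 < α)
    (hn : Tendsto (fun u : ℕ => ((n u : ℕ) : ℝ) / (u : ℝ)) atTop (𝓝 α)) {s : ℝ} (hs : 0 < s) :
    Tendsto (fun u : ℕ => circleTheta (n u) ((u : ℝ) ^ 2 * s)) atTop
      (𝓝 (gaussTheta ((2 * Real.pi) ^ 2 / α ^ 2 * s))) := by
  simp_rw [circleTheta_eq_tsum]
  have hn_top : Tendsto (fun u : ℕ => (n u : ℝ)) atTop atTop := by
    refine tendsto_atTop_mono' _ ?_
      (tendsto_natCast_atTop_atTop.const_mul_atTop (half_pos hα))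
    filter_upwards [eventually_le_mul hα hn] with u h using h.2.1
  refine tendsto_tsum_of_dominated_convergence
    (bound := fun m : ℤ => Real.exp (-(4 / α ^ 2 * s * (m : ℝ) ^ 2)))
    (summable_gaussTheta (by positivity)) (fun m => ?_) ?_
  · have h1 : Tendsto (fun u : ℕ => 2 * (u : ℝ) * Real.sin (Real.pi * m / n u)) atTop
        (𝓝 (2 * Real.pi * m / α)) := by
      apply tendsto_mul_sin
      · exact tendsto_const_nhds.div_atTop hn_top
      · have := (hn.inv₀ hα.ne').const_mul (2 * Real.pi * m)
        refine (this.congr fun u => ?_)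
        rw [inv_div]; ring
    have h2 : Tendsto (fun u : ℕ =>
        Real.exp (-((2 * (u : ℝ) * Real.sin (Real.pi * m / n u)) ^ 2 * s))) atTop
        (𝓝 (Real.exp (-((2 * Real.pi * m / α) ^ 2 * s)))) :=
      (Real.continuous_exp.tendsto _).comp ((h1.pow 2).mul_const s).neg
    rw [show (2 * Real.pi) ^ 2 / α ^ 2 * s * (m : ℝ) ^ 2 = (2 * Real.pi * m / α) ^ 2 * s by
      ring]
    refine h2.congr' ?_
    filter_upwards [hn_top.eventually_gt_atTop (|(m : ℝ)| * 2)] with u hu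
    have hu' : |m| * 2 < (n u : ℤ) := by exact_mod_cast hu
    have hm := abs_lt.1 (by rwa [abs_mul, abs_two] : |m * 2| < (n u : ℤ))
    have hmem : m ∈ leastResidues (n u) := ⟨hm.1, hm.2.le⟩
    rw [indicator_of_mem hmem]
    congr 1
    have h4 := Real.cos_sq' (Real.pi * m / n u)
    have h5 := Real.cos_two_mul (Real.pi * m / n u)
    rw [show 2 * (Real.pi * m / n u) = 2 * Real.pi * m / n u by ring] at h5
    rw [h5, h4]
    ring
  · filter_upwards [eventually_le_sixteen_mul_div hα hn] with u h m
    rw [Real.norm_of_nonneg (indicator_nonneg (fun _ _ => (Real.exp_pos _).le) m)]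
    refine (indicator_le_gauss (n u) (by positivity) m).trans ?_
    have := h s hs.le
    gcongr

/-- The diagonal of the heat kernel of `ℤ` has the heat kernel of `ℝ` as its scaling limit. -/
theorem tendsto_mul_returnProb
    (hn : Tendsto (fun u : ℕ => ((n u : ℕ) : ℝ) / (u : ℝ)) atTop (𝓝 α)) {s : ℝ} (hs : 0 < s) :
    Tendsto (fun u : ℕ => n u * returnProb ((u : ℝ) ^ 2 * s)) atTop
      (𝓝 (α * (1 / √(4 * Real.pi) * (1 / √s)))) := by
  have hu : Tendsto (fun u : ℕ => (u : ℝ) ^ 2 * s) atTop atTop :=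
    ((tendsto_pow_atTop two_ne_zero).comp tendsto_natCast_atTop_atTop).atTop_mul_const hs
  refine (hn.mul ((tendsto_sqrt_mul_returnProb.comp hu).mul_const (1 / √s))).congr' ?_
  filter_upwards [eventually_gt_atTop 0] with u hu
  have hu' : (0 : ℝ) < u := by exact_mod_cast hu
  have := Real.sqrt_pos.2 hs
  simp only [Function.comp_apply]
  rw [Real.sqrt_mul (by positivity), Real.sqrt_sq hu'.le]
  field_simp

end Limit

end DiscreteTorus

/-! ### Integrability against `dt/t` and Frullani's integral. -/

section Integrability

lemma integrableOn_Ioc_div_self {g : ℝ → ℝ} (hg : ContinuousOn g (Ioi 0)) {C : ℝ}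
    (h : ∀ t ∈ Ioc (0 : ℝ) 1, |g t| ≤ C * t) :
    IntegrableOn (fun t => g t / t) (Ioc 0 1) := by
  refine IntegrableOn.of_bound (by simp) ?_ C ?_
  · exact ((hg.mono Ioc_subset_Ioi_self).div continuousOn_id
      fun t ht => ht.1.ne').aestronglyMeasurable measurableSet_Ioc
  · filter_upwards [ae_restrict_mem measurableSet_Ioc] with t ht
    rw [norm_div, Real.norm_of_nonneg ht.1.le, div_le_iff₀ ht.1]
    exact h t ht

lemma integrableOn_Ioi_div_self {g : ℝ → ℝ} (hg : ContinuousOn g (Ioi 0)) {C r : ℝ} (hr : 0 < r)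
    (h : ∀ t ∈ Ioi (1 : ℝ), |g t| ≤ C * t ^ (-r)) :
    IntegrableOn (fun t => g t / t) (Ioi 1) := by
  refine ((integrableOn_Ioi_rpow_of_lt (by linarith : -r - 1 < -1) one_pos).const_mul C).mono' ?_ ?_
  · have hs : Ioi (1 : ℝ) ⊆ Ioi 0 := Ioi_subset_Ioi zero_le_one
    exact ((hg.mono hs).div continuousOn_id fun t ht => (hs ht).ne').aestronglyMeasurable
      measurableSet_Ioi
  · filter_upwards [ae_restrict_mem measurableSet_Ioi] with t (ht : 1 < t)
    have ht0 : 0 < t := by linarith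
    rw [norm_div, Real.norm_of_nonneg ht0.le, Real.rpow_sub_one ht0.ne', ← mul_div_assoc]
    gcongr
    exact h t ht

lemma integrableOn_Ioi_zero_div_self {g : ℝ → ℝ} (hg : ContinuousOn g (Ioi 0)) {C D r : ℝ}
    (hr : 0 < r) (h : ∀ t ∈ Ioc (0 : ℝ) 1, |g t| ≤ C * t)
    (h' : ∀ t ∈ Ioi (1 : ℝ), |g t| ≤ D * t ^ (-r)) :
    IntegrableOn (fun t => g t / t) (Ioi 0) := by
  rw [← Ioc_union_Ioi_eq_Ioi zero_le_one]
  exact (integrableOn_Ioc_div_self hg h).union (integrableOn_Ioi_div_self hg hr h')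

lemma exp_neg_le_inv_mul {c t : ℝ} (hc : 0 < c) (ht : 0 < t) :
    Real.exp (-(c * t)) ≤ c⁻¹ * t ^ (-1 : ℝ) := by
  rw [Real.rpow_neg_one, ← mul_inv, Real.exp_neg]
  exact inv_anti₀ (by positivity) (by linarith [Real.add_one_le_exp (c * t)])

lemma abs_exp_sub_one_le {x : ℝ} (hx : 0 ≤ x) : |Real.exp (-x) - 1| ≤ x := by
  rw [abs_le]
  constructor
  · linarith [Real.add_one_le_exp (-x)]
  · linarith [Real.exp_le_one_iff.2 (neg_nonpos.2 hx)]

lemma integrableOn_exp_sub_exp_div {c : ℝ} (hc : 0 < c) :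
    IntegrableOn (fun t => (Real.exp (-t) - Real.exp (-(c * t))) / t) (Ioi 0) := by
  refine integrableOn_Ioi_zero_div_self (by fun_prop) (C := 1 + c) (D := 1 + c⁻¹) one_pos
    (fun t ht => ?_) (fun t (ht : 1 < t) => ?_)
  · have h1 := abs_le.1 (abs_exp_sub_one_le ht.1.le)
    have h2 := abs_le.1 (abs_exp_sub_one_le (mul_nonneg hc.le ht.1.le))
    rw [abs_le]
    constructor <;> linarith [h1.1, h1.2, h2.1, h2.2]
  · have ht0 : 0 < t := by linarith
    have h1 := exp_neg_le_inv_mul one_pos ht0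
    have h2 := exp_neg_le_inv_mul hc ht0
    rw [one_mul, inv_one] at h1
    have h3 := Real.exp_pos (-t)
    have h4 := Real.exp_pos (-(c * t))
    rw [abs_le]
    constructor <;> linarith

/-- Frullani's integral for the exponential function. -/
theorem integral_exp_sub_exp_div {c : ℝ} (hc : 0 < c) :
    ∫ t in Ioi (0 : ℝ), (Real.exp (-t) - Real.exp (-(c * t))) / t = Real.log c := by
  have hcont : Continuous fun t : ℝ => Real.exp (-t) := by fun_prop
  have h := Frullani.integral_Ioi_eq (f := fun t : ℝ => Real.exp (-t)) (a := 1) (b := c) (L := 1)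
    (R := 0) (hcont.locallyIntegrable.locallyIntegrableOn _) one_pos hc
    (Tendsto.mono_left (by simpa using hcont.tendsto 0) nhdsWithin_le_nhds)
    Real.tendsto_exp_neg_atTop_nhds_zero
    (by simpa [div_eq_inv_mul] using integrableOn_exp_sub_exp_div hc)
  simpa [div_eq_inv_mul] using h

end Integrability

/-! ### An integral for the Euler–Mascheroni constant. -/

section EulerMascheroni

lemma integrableOn_log_mul_exp :
    IntegrableOn (fun t : ℝ => Real.log t * Real.exp (-t)) (Ioi 0) := by
  rw [← Ioc_union_Ioi_eq_Ioi zero_le_one]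
  refine IntegrableOn.union ?_ ?_
  · have h : IntegrableOn Real.log (Ioc 0 1) :=
      (intervalIntegrable_iff_integrableOn_Ioc_of_le zero_le_one).1
        intervalIntegral.intervalIntegrable_log'
    refine h.norm.mono' ?_ ?_
    · exact h.aestronglyMeasurable.mul (Continuous.aestronglyMeasurable (by fun_prop))
    · filter_upwards [ae_restrict_mem measurableSet_Ioc] with t ht
      rw [norm_mul, Real.norm_of_nonneg (Real.exp_pos _).le]
      exact mul_le_of_le_one_right (norm_nonneg _) (Real.exp_le_one_iff.2 (by linarith [ht.1]))
  · have h := (Real.GammaIntegral_convergent (s := 2) two_pos).mono_set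
      (Ioi_subset_Ioi zero_le_one)
    refine h.mono' ?_ ?_
    · exact (Real.measurable_log.mul (by fun_prop)).aestronglyMeasurable
    · filter_upwards [ae_restrict_mem measurableSet_Ioi] with t (ht : 1 < t)
      rw [norm_mul, Real.norm_of_nonneg (Real.exp_pos _).le, mul_comm,
        Real.norm_of_nonneg (Real.log_nonneg ht.le), show (2 : ℝ) - 1 = 1 by norm_num,
        Real.rpow_one]
      gcongr
      linarith [Real.log_le_sub_one_of_pos (by linarith : 0 < t)]

/-- Differentiation of the Gamma integral at `1`, where the derivative of `Γ` is `-γ`. -/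
lemma integral_log_mul_exp :
    ∫ t in Ioi (0 : ℝ), Real.log t * Real.exp (-t) = -Real.eulerMascheroniConstant := by
  have h1 := Complex.hasDerivAt_GammaIntegral (s := 1) (by simp)
  have h2 : Complex.GammaIntegral =ᶠ[𝓝 1] Complex.Gamma := by
    have : {s : ℂ | 0 < s.re} ∈ 𝓝 (1 : ℂ) :=
      (isOpen_lt continuous_const Complex.continuous_re).mem_nhds (by simp)
    filter_upwards [this] with s hs
    exact (Complex.Gamma_eq_integral hs).symm
  have h3 := (h1.congr_of_eventuallyEq h2.symm).unique Complex.hasDerivAt_Gamma_one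
  simp only [sub_self, Complex.cpow_zero, one_mul, ← Complex.ofReal_mul] at h3
  rw [integral_complex_ofReal, ← Complex.ofReal_neg, Complex.ofReal_inj] at h3
  exact h3

lemma integrableOn_one_sub_exp_div :
    IntegrableOn (fun t : ℝ => (1 - Real.exp (-t)) / t) (Ioc 0 1) :=
  integrableOn_Ioc_div_self (by fun_prop) (C := 1) fun t ht => by
    rw [abs_sub_comm, one_mul]
    exact abs_exp_sub_one_le ht.1.le

lemma integrableOn_exp_div : IntegrableOn (fun t : ℝ => Real.exp (-t) / t) (Ioi 1) :=
  integrableOn_Ioi_div_self (by fun_prop) (C := 1) one_pos fun t (ht : 1 < t) => by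
    have := exp_neg_le_inv_mul one_pos (by linarith : 0 < t)
    rw [abs_of_pos (Real.exp_pos _)]
    simpa using this

/-- The Euler–Mascheroni constant as an integral. -/
theorem integral_exp_div_sub :
    (∫ t in Ioi (1 : ℝ), Real.exp (-t) / t) - ∫ t in Ioc (0 : ℝ) 1, (1 - Real.exp (-t)) / t =
      -Real.eulerMascheroniConstant := by
  have hlog := integrableOn_log_mul_exp
  have hI : IntegrableOn (fun t : ℝ => Real.log t * Real.exp (-t)) (Ioc 0 1) :=
    hlog.mono_set Ioc_subset_Ioi_self
  have hJ : IntegrableOn (fun t : ℝ => Real.log t * Real.exp (-t)) (Ioi 1) :=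
    hlog.mono_set (Ioi_subset_Ioi zero_le_one)
  have hexp (t : ℝ) : HasDerivAt (fun t : ℝ => Real.exp (-t)) (-Real.exp (-t)) t := by
    simpa using (hasDerivAt_neg t).exp
  have h1 : (∫ t in Ioc (0 : ℝ) 1, Real.log t * Real.exp (-t)) +
      ∫ t in Ioc (0 : ℝ) 1, (1 - Real.exp (-t)) / t = 0 := by
    rw [← integral_add hI integrableOn_one_sub_exp_div,
      ← intervalIntegral.integral_of_le zero_le_one]
    rw [intervalIntegral.integral_eq_sub_of_hasDerivAt_of_tendsto
      -- Integration by parts with the primitive of `e^{-t}` that vanishes at `0`; on `(1, ∞)` the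
      -- one that vanishes at infinity is used. The boundary terms at `1` vanish with `log 1`.
      (f := fun t => (1 - Real.exp (-t)) * Real.log t) (fa := 0) (fb := 0) zero_lt_one, sub_zero]
    · intro t ht
      have h := ((hexp t).const_sub 1).mul (Real.hasDerivAt_log ht.1.ne')
      exact h.congr_deriv (by ring)
    · rw [intervalIntegrable_iff_integrableOn_Ioc_of_le zero_le_one]
      exact hI.add integrableOn_one_sub_exp_div
    · have h : Tendsto (fun t : ℝ => |t * Real.log t|) (𝓝[>] 0) (𝓝 0) := by
        have := (Real.continuous_mul_log.abs.tendsto 0).mono_left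
          (nhdsWithin_le_nhds (s := Ioi (0 : ℝ)))
        simpa using this
      refine squeeze_zero_norm' ?_ h
      filter_upwards [self_mem_nhdsWithin] with t (ht : 0 < t)
      rw [norm_mul, abs_mul, Real.norm_eq_abs, Real.norm_eq_abs, abs_sub_comm, abs_of_pos ht]
      gcongr
      exact abs_exp_sub_one_le ht.le
    · have h : ContinuousAt (fun t : ℝ => (1 - Real.exp (-t)) * Real.log t) 1 := by
        fun_prop (disch := norm_num)
      have := h.tendsto.mono_left (nhdsWithin_le_nhds (s := Iio (1 : ℝ)))
      simpa using this
  have h2 : (∫ t in Ioi (1 : ℝ), Real.log t * Real.exp (-t)) -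
      ∫ t in Ioi (1 : ℝ), Real.exp (-t) / t = 0 := by
    rw [← integral_sub hJ integrableOn_exp_div]
    rw [integral_Ioi_of_hasDerivAt_of_tendsto' (f := fun t => -(Real.exp (-t) * Real.log t))
      (m := 0)]
    · simp
    · intro t (ht : 1 ≤ t)
      have h := ((hexp t).mul (Real.hasDerivAt_log (by linarith : t ≠ 0))).neg
      exact h.congr_deriv (by ring)
    · exact hJ.sub integrableOn_exp_div
    · have h : Tendsto (fun t : ℝ => t * Real.exp (-t)) atTop (𝓝 0) := by
        simpa using Real.tendsto_pow_mul_exp_neg_atTop_nhds_zero 1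
      refine squeeze_zero_norm' ?_ h
      filter_upwards [eventually_ge_atTop 1] with t ht
      rw [norm_neg, norm_mul, Real.norm_of_nonneg (Real.exp_pos _).le,
        Real.norm_of_nonneg (Real.log_nonneg ht), mul_comm]
      gcongr
      linarith [Real.log_le_sub_one_of_pos (by linarith : 0 < t)]
  have h3 := integral_log_mul_exp
  rw [← Ioc_union_Ioi_eq_Ioi zero_le_one, setIntegral_union
    (Ioc_disjoint_Ioi le_rfl) measurableSet_Ioi hI hJ] at h3
  linarith

end EulerMascheroni

lemma hasSum_prod_pi {d : ℕ} {f : Fin d → ℤ → ℝ} (hf : ∀ j, Summable (f j))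
    (h0 : ∀ j m, 0 ≤ f j m) :
    HasSum (fun m : Fin d → ℤ => ∏ j, f j (m j)) (∏ j, ∑' m, f j m) := by
  induction d with
  | zero => simp
  | succ d ih =>
    have h1 := (hf 0).hasSum
    have h2 := ih (f := fun j => f j.succ) (fun j => hf _) (fun j => h0 _)
    have h3 := (hf 0).mul_of_nonneg h2.summable (h0 0)
      fun m => Finset.prod_nonneg fun j _ => h0 _ _
    have h4 := h1.mul h2 h3
    rw [Fin.prod_univ_succ, ← (Fin.consEquiv fun _ => ℤ).hasSum_iff]
    refine h4.congr_fun fun p => ?_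
    simp [Fin.consEquiv, Fin.prod_univ_succ]

/-! ### The spectral zeta function of a rectangular torus and its derivative at `0`. -/

namespace RealTorus

variable {d : ℕ} {α : Fin d → ℝ}

lemma eigenvalue_diagonal (hα : ∀ j, 0 < α j) (m : Fin d → ℤ) :
    eigenvalue (Matrix.diagonal α) m = ∑ j, (2 * Real.pi) ^ 2 / α j ^ 2 * (m j : ℝ) ^ 2 := by
  have h : (Matrix.diagonal α)ᵀ⁻¹ = Matrix.diagonal fun j => (α j)⁻¹ := by
    apply Matrix.inv_eq_right_inv
    rw [Matrix.diagonal_transpose, Matrix.diagonal_mul_diagonal, ← Matrix.diagonal_one]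
    congr 1
    funext j
    exact mul_inv_cancel₀ (hα j).ne'
  rw [eigenvalue, h, dotProduct, Finset.mul_sum]
  refine Finset.sum_congr rfl fun j _ => ?_
  rw [Matrix.mulVec_diagonal]
  ring

lemma hasSum_theta_diagonal (hα : ∀ j, 0 < α j) {t : ℝ} (ht : 0 < t) :
    HasSum (fun m : Fin d → ℤ => Real.exp (-eigenvalue (Matrix.diagonal α) m * t))
      (∏ j, gaussTheta ((2 * Real.pi) ^ 2 / α j ^ 2 * t)) := by
  have h := hasSum_prod_pi
    (f := fun j (m : ℤ) => Real.exp (-((2 * Real.pi) ^ 2 / α j ^ 2 * t * (m : ℝ) ^ 2)))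
    (fun j => summable_gaussTheta (by have := hα j; positivity)) fun _ _ => (Real.exp_pos _).le
  refine h.congr_fun fun m => ?_
  rw [← Real.exp_sum, eigenvalue_diagonal hα, ← Finset.sum_neg_distrib, Finset.sum_mul]
  congr 1
  refine Finset.sum_congr rfl fun j _ => by ring

lemma theta_diagonal (hα : ∀ j, 0 < α j) {t : ℝ} (ht : 0 < t) :
    theta (Matrix.diagonal α) t = ∏ j, gaussTheta ((2 * Real.pi) ^ 2 / α j ^ 2 * t) :=
  (hasSum_theta_diagonal hα ht).tsum_eq

/-- The coefficient of the leading term of the theta function of the real torus at `0`. -/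
def thetaCoeff (α : Fin d → ℝ) : ℝ := ∏ j, α j / √(4 * Real.pi)

/-- Poisson summation in each coordinate, in the form of the functional equation that `WeakFEPair`
asks for; the dual scale is `π² / ((2π)²/α²) = α²/4`. -/
lemma prod_gaussTheta_one_div (hα : ∀ j, 0 < α j) {x : ℝ} (hx : 0 < x) :
    ∏ j, gaussTheta ((2 * Real.pi) ^ 2 / α j ^ 2 * (1 / x)) =
      thetaCoeff α * x ^ ((d : ℝ) / 2) * ∏ j, gaussTheta (α j ^ 2 / 4 * x) := by
  have h (j : Fin d) : gaussTheta ((2 * Real.pi) ^ 2 / α j ^ 2 * (1 / x)) =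
      α j / √(4 * Real.pi) * √x * gaussTheta (α j ^ 2 / 4 * x) := by
    have hj := hα j
    have hpi := Real.pi_pos
    rw [gaussTheta_inv (by positivity)]
    congr 1
    · rw [Real.sqrt_eq_iff_mul_self_eq (by positivity) (by positivity)]
      rw [mul_mul_mul_comm, Real.mul_self_sqrt hx.le, div_mul_div_comm (α j),
        Real.mul_self_sqrt (by positivity)]
      field_simp
      norm_num
    · congr 1
      field_simp
      ring
  simp_rw [h, Finset.prod_mul_distrib]
  rw [Finset.prod_const, Finset.card_univ, Fintype.card_fin, Real.sqrt_eq_rpow x,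
    ← Real.rpow_mul_natCast hx.le, thetaCoeff]
  congr 3
  ring

lemma thetaCoeff_pos (hα : ∀ j, 0 < α j) : 0 < thetaCoeff α :=
  Finset.prod_pos fun j _ => div_pos (hα j) (Real.sqrt_pos.2 (by positivity))

lemma heat_scale_pos (hα : ∀ j, 0 < α j) (j : Fin d) : 0 < (2 * Real.pi) ^ 2 / α j ^ 2 := by
  have := hα j
  positivity

lemma dual_scale_pos (hα : ∀ j, 0 < α j) (j : Fin d) : 0 < α j ^ 2 / 4 := by
  have := hα j
  positivity

/-- The theta functions of a rectangular torus and of its dual. -/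
def thetaPair (hd : 1 ≤ d) (hα : ∀ j, 0 < α j) : WeakFEPair ℂ where
  f t := ((∏ j, gaussTheta ((2 * Real.pi) ^ 2 / α j ^ 2 * t) : ℝ) : ℂ)
  g t := ((∏ j, gaussTheta (α j ^ 2 / 4 * t) : ℝ) : ℂ)
  k := (d : ℝ) / 2
  ε := thetaCoeff α
  f₀ := 1
  g₀ := 1
  hf_int := (Complex.continuous_ofReal.comp_continuousOn
    (continuousOn_prod_gaussTheta _ (heat_scale_pos hα))).locallyIntegrableOn measurableSet_Ioi
  hg_int := (Complex.continuous_ofReal.comp_continuousOn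
    (continuousOn_prod_gaussTheta _ (dual_scale_pos hα))).locallyIntegrableOn measurableSet_Ioi
  hk := by
    have : (0 : ℝ) < d := by exact_mod_cast hd
    positivity
  hε := Complex.ofReal_ne_zero.2 (thetaCoeff_pos hα).ne'
  h_feq x hx := by
    rw [prod_gaussTheta_one_div hα hx, smul_eq_mul]
    push_cast
    rfl
  hf_top r := by
    refine IsBigO.congr_left (Complex.isBigO_ofReal_left.2
      (isBigO_prod_gaussTheta_sub_one Finset.univ (heat_scale_pos hα) r)) fun t => ?_
    push_cast
    rfl
  hg_top r := by
    refine IsBigO.congr_left (Complex.isBigO_ofReal_left.2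
      (isBigO_prod_gaussTheta_sub_one Finset.univ (dual_scale_pos hα) r)) fun t => ?_
    push_cast
    rfl

/-- The meromorphic continuation of the spectral zeta function of a rectangular torus. -/
def zetaContinuation (hd : 1 ≤ d) (hα : ∀ j, 0 < α j) (s : ℂ) : ℂ :=
  (Complex.Gamma s)⁻¹ * ((thetaPair hd hα).Λ₀ s - thetaCoeff α / ((d : ℂ) / 2 - s)) -
    (Complex.Gamma (s + 1))⁻¹

lemma differentiable_one_div_Gamma_add_one :
    Differentiable ℂ fun s : ℂ => (Complex.Gamma (s + 1))⁻¹ :=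
  Complex.differentiable_one_div_Gamma.comp (differentiable_id.add_const 1)

theorem isSpectralZeta_zetaContinuation (hd : 1 ≤ d) (hα : ∀ j, 0 < α j) :
    IsSpectralZeta (Matrix.diagonal α) (zetaContinuation hd hα) := by
  refine ⟨fun s _ => ?_, fun s hs => ?_, fun s hs => ?_⟩
  · have h1 : MeromorphicAt (fun s : ℂ => (Complex.Gamma s)⁻¹) s :=
      (Complex.differentiable_one_div_Gamma.analyticAt s).meromorphicAt
    have h2 : MeromorphicAt (thetaPair hd hα).Λ₀ s :=
      ((thetaPair hd hα).differentiable_Λ₀.analyticAt s).meromorphicAt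
    have h3 : MeromorphicAt (fun s : ℂ => (Complex.Gamma (s + 1))⁻¹) s :=
      (differentiable_one_div_Gamma_add_one.analyticAt s).meromorphicAt
    have h4 : MeromorphicAt (fun s : ℂ => (thetaCoeff α : ℂ) / ((d : ℂ) / 2 - s)) s :=
      (MeromorphicAt.const _ s).div ((MeromorphicAt.const _ s).sub (MeromorphicAt.id s))
    exact (h1.mul (h2.sub h4)).sub h3
  · have hs' : (d : ℂ) / 2 - s ≠ 0 := sub_ne_zero.2 (Ne.symm hs)
    have h4 : DifferentiableAt ℂ (fun s : ℂ => (thetaCoeff α : ℂ) / ((d : ℂ) / 2 - s)) s := by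
      fun_prop (disch := exact hs')
    exact (((Complex.differentiable_one_div_Gamma s).mul
      (((thetaPair hd hα).differentiable_Λ₀ s).sub h4)).sub
      (differentiable_one_div_Gamma_add_one s)).differentiableWithinAt
  · have h := (thetaPair hd hα).hasMellin (s := s) hs
    have e : EqOn (fun t : ℝ => ((theta (Matrix.diagonal α) t - 1 : ℝ) : ℂ))
        (fun t => (thetaPair hd hα).f t - (thetaPair hd hα).f₀) (Ioi 0) := fun t ht => by
      simp only [theta_diagonal hα ht, thetaPair]
      push_cast
      rfl
    have e' : EqOn (fun t : ℝ => (t : ℂ) ^ (s - 1) •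
        ((theta (Matrix.diagonal α) t - 1 : ℝ) : ℂ))
        (fun t => (t : ℂ) ^ (s - 1) • ((thetaPair hd hα).f t - (thetaPair hd hα).f₀)) (Ioi 0) :=
      fun t ht => congrArg ((t : ℂ) ^ (s - 1) • ·) (e ht)
    refine ⟨(integrableOn_congr_fun e' measurableSet_Ioi).2 h.1, ?_⟩
    have hm : mellin (fun t => ((theta (Matrix.diagonal α) t - 1 : ℝ) : ℂ)) s =
        (thetaPair hd hα).Λ s := by
      rw [← h.2]
      exact setIntegral_congr_fun measurableSet_Ioi e'
    have hs0 : s ≠ 0 := by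
      rintro rfl
      have : (0 : ℝ) ≤ d / 2 := by positivity
      exact absurd hs (by simpa using this)
    -- `Λ` is `Λ₀` minus polar parts at `0` and `d / 2`. The pole at `0` is absorbed by `1/(s Γ(s))
    -- = 1/Γ(s + 1)`, leaving only the one at `d / 2`.
    rw [hm, zetaContinuation, WeakFEPair.Λ, Complex.Gamma_add_one s hs0]
    simp only [thetaPair, smul_eq_mul, mul_one, mul_inv, one_div]
    push_cast
    ring

theorem isSpectralZeta_spectralZeta (hd : 1 ≤ d) (hα : ∀ j, 0 < α j) :
    IsSpectralZeta (Matrix.diagonal α) (spectralZeta (Matrix.diagonal α)) :=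
  Classical.epsilon_spec (p := IsSpectralZeta (Matrix.diagonal α))
    ⟨_, isSpectralZeta_zetaContinuation hd hα⟩

/-- At `0` the function `1/Γ(s)` has a simple zero with derivative `1`, so only the value of its
cofactor survives; the derivative of `1/Γ(s + 1)` there is `γ`. -/
lemma deriv_zetaContinuation (hd : 1 ≤ d) (hα : ∀ j, 0 < α j) :
    deriv (zetaContinuation hd hα) 0 = (thetaPair hd hα).Λ₀ 0 - thetaCoeff α / ((d : ℂ) / 2) -
      Real.eulerMascheroniConstant := by
  have hG : HasDerivAt (fun s : ℂ => (Complex.Gamma (s + 1))⁻¹) Real.eulerMascheroniConstant 0 := by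
    have h1 : HasDerivAt Complex.Gamma (-Real.eulerMascheroniConstant) (0 + 1) := by
      simpa using Complex.hasDerivAt_Gamma_one
    have h2 := (h1.comp_add_const 0 1).inv (by simp)
    exact h2.congr_deriv (by simp)
  have hG0 : HasDerivAt (fun s : ℂ => (Complex.Gamma s)⁻¹) 1 0 := by
    have h := (hasDerivAt_id (0 : ℂ)).mul hG
    simp only [id_eq, zero_add, Complex.Gamma_one, inv_one, mul_one, zero_mul, add_zero] at h
    refine h.congr_of_eventuallyEq (Eventually.of_forall fun s => ?_)
    exact Complex.one_div_Gamma_eq_self_mul_one_div_Gamma_add_one s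
  have hd0 : (d : ℂ) / 2 - 0 ≠ 0 := by
    have : (d : ℂ) ≠ 0 := by exact_mod_cast (by omega : d ≠ 0)
    simpa using this
  have hr : DifferentiableAt ℂ (fun s : ℂ => (thetaPair hd hα).Λ₀ s -
      thetaCoeff α / ((d : ℂ) / 2 - s)) 0 := by
    refine ((thetaPair hd hα).differentiable_Λ₀ 0).sub ?_
    fun_prop (disch := exact hd0)
  have h := (hG0.mul hr.hasDerivAt).sub hG
  refine h.deriv.trans ?_
  simp

/-- The chosen continuation is determined away from `d / 2`, and `0 ≠ d / 2` since `d ≥ 1`; hence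
the derivative at `0` does not depend on the choice. -/
lemma deriv_spectralZeta (hd : 1 ≤ d) (hα : ∀ j, 0 < α j) :
    deriv (spectralZeta (Matrix.diagonal α)) 0 = (thetaPair hd hα).Λ₀ 0 -
      thetaCoeff α / ((d : ℂ) / 2) - Real.eulerMascheroniConstant := by
  rw [← deriv_zetaContinuation hd hα]
  apply Filter.EventuallyEq.deriv_eq
  have hd0 : (0 : ℂ) ∈ ({(d / 2 : ℂ)}ᶜ : Set ℂ) := by
    have : (d : ℂ) ≠ 0 := by exact_mod_cast (by omega : d ≠ 0)
    exact fun h => this (by simpa using h.symm)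
  exact ((isSpectralZeta_spectralZeta hd hα).eqOn
    (isSpectralZeta_zetaContinuation hd hα)).eventuallyEq_of_mem
      (isOpen_compl_singleton.mem_nhds hd0)

/-- The integrand, with respect to `ds` on `(0, ∞)`, of the derivative of the spectral zeta
function at `0`. -/
def derivIntegrand (α : Fin d → ℝ) (s : ℝ) : ℝ :=
  (∏ j, gaussTheta ((2 * Real.pi) ^ 2 / α j ^ 2 * s) - thetaCoeff α * s ^ (-((d : ℝ) / 2)) - 1 +
    Real.exp (-s)) / s

/-- The derivative at `0` of the spectral zeta function as an integral. -/
theorem deriv_spectralZeta_eq_integral (hd : 1 ≤ d) (hα : ∀ j, 0 < α j) :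
    deriv (spectralZeta (Matrix.diagonal α)) 0 =
      ((∫ s in Ioi (0 : ℝ), derivIntegrand α s : ℝ) : ℂ) := by
  have hd' : (0 : ℝ) < (d : ℝ) / 2 := by
    have : (0 : ℝ) < d := by exact_mod_cast hd
    positivity
  set P := thetaPair hd hα with hP
  -- `Λ₀ 0` is the integral of `M`: theta minus its small-time leading term on `(0, 1)`, theta minus
  -- `1` on `(1, ∞)`. The functions `a`, `b`, `c` below are what separates this from
  -- `derivIntegrand`.
  set M : ℝ → ℂ := fun t => (t : ℂ) ^ ((0 : ℂ) - 1) • P.f_modif t with hM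
  have hMint : IntegrableOn M (Ioi 0) := (P.isStrongFEPair_toStrongFEPair.hasMellin 0).1
  have hM1 : IntegrableOn M (Ioc 0 1) := hMint.mono_set Ioc_subset_Ioi_self
  have hM2 : IntegrableOn M (Ioi 1) := hMint.mono_set (Ioi_subset_Ioi zero_le_one)
  have hL : P.Λ₀ 0 = (∫ t in Ioc (0 : ℝ) 1, M t) + ∫ t in Ioi (1 : ℝ), M t := by
    rw [← setIntegral_union (Ioc_disjoint_Ioi le_rfl) measurableSet_Ioi hM1 hM2,
      Ioc_union_Ioi_eq_Ioi zero_le_one]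
    rfl
  set a : ℝ → ℂ := fun t => (((1 - Real.exp (-t)) / t : ℝ) : ℂ) with ha
  set b : ℝ → ℂ := fun t => ((Real.exp (-t) / t : ℝ) : ℂ) with hb
  set c : ℝ → ℂ := fun t => ((thetaCoeff α * t ^ (-((d : ℝ) / 2) - 1) : ℝ) : ℂ) with hc
  have hai : IntegrableOn a (Ioc 0 1) := integrableOn_one_sub_exp_div.ofReal
  have hbi : IntegrableOn b (Ioi 1) := integrableOn_exp_div.ofReal
  have hci : IntegrableOn c (Ioi 1) :=
    ((integrableOn_Ioi_rpow_of_lt (by linarith) one_pos).const_mul _).ofReal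
  have e1 : ∀ᵐ t ∂volume.restrict (Ioc (0 : ℝ) 1), (derivIntegrand α t : ℂ) = M t - a t := by
    -- The point `1` is discarded because `f_modif` is defined to vanish there.
    rw [← restrict_Ioo_eq_restrict_Ioc]
    filter_upwards [ae_restrict_mem measurableSet_Ioo] with t ht
    have h1 : t ∉ Ioi (1 : ℝ) := not_lt.2 ht.2.le
    simp only [hM, ha, WeakFEPair.f_modif, Pi.add_apply, indicator_of_notMem h1,
      indicator_of_mem ht, derivIntegrand, zero_sub, Complex.cpow_neg_one, hP, thetaPair,
      smul_eq_mul]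
    push_cast
    ring
  have e2 : EqOn (fun t => (derivIntegrand α t : ℂ)) (fun t => M t + b t - c t) (Ioi 1) := by
    intro t (ht : 1 < t)
    have ht0 : t ≠ 0 := by linarith
    have h1 : t ∉ Ioo (0 : ℝ) 1 := fun h => by linarith [h.2]
    simp only [hM, hb, hc, WeakFEPair.f_modif, Pi.add_apply, indicator_of_notMem h1,
      indicator_of_mem (mem_Ioi.2 ht), derivIntegrand, zero_sub, Complex.cpow_neg_one, hP,
      thetaPair, smul_eq_mul, Real.rpow_sub_one ht0]
    push_cast
    ring
  have i1 : IntegrableOn (fun t => (derivIntegrand α t : ℂ)) (Ioc 0 1) :=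
    (hM1.sub hai).congr (e1.mono fun t h => h.symm)
  have i2 : IntegrableOn (fun t => (derivIntegrand α t : ℂ)) (Ioi 1) :=
    (integrableOn_congr_fun e2 measurableSet_Ioi).2 ((hM2.add hbi).sub hci)
  have hci' : ∫ t in Ioi (1 : ℝ), c t = thetaCoeff α / ((d : ℂ) / 2) := by
    rw [hc, integral_complex_ofReal, integral_const_mul,
      integral_Ioi_rpow_of_lt (by linarith) one_pos]
    simp only [sub_add_cancel, Real.one_rpow]
    push_cast
    rw [neg_div_neg_eq]
    ring
  rw [deriv_spectralZeta hd hα, ← integral_complex_ofReal, ← Ioc_union_Ioi_eq_Ioi zero_le_one,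
    setIntegral_union (Ioc_disjoint_Ioi le_rfl) measurableSet_Ioi i1 i2, integral_congr_ae e1,
    setIntegral_congr_fun measurableSet_Ioi e2, integral_sub hM1 hai,
    integral_sub (f := fun t => M t + b t) (hM2.add hbi) hci, integral_add hM2 hbi, hci', ← hP, hL]
  have hγ := congrArg (fun x : ℝ => (x : ℂ)) integral_exp_div_sub
  simp only [Complex.ofReal_sub, Complex.ofReal_neg, ← integral_complex_ofReal] at hγ
  linear_combination -hγ

end RealTorus

/-- Telescoping: change one factor at a time, bounding the others by `A`. -/
lemma prod_sub_prod_le {ι : Type*} (S : Finset ι) {a b : ι → ℝ} {A ε : ℝ} (hA : 1 ≤ A)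
    (hε : 0 ≤ ε) (hb : ∀ j, 0 ≤ b j) (hba : ∀ j, b j ≤ a j) (haA : ∀ j, a j ≤ A)
    (hab : ∀ j, a j - b j ≤ ε) :
    ∏ j ∈ S, a j - ∏ j ∈ S, b j ≤ S.card * A ^ S.card * ε := by
  classical
  induction S using Finset.induction_on with
  | empty => simp
  | insert i S hi ih =>
    rw [Finset.prod_insert hi, Finset.prod_insert hi, Finset.card_insert_of_notMem hi]
    have h1 : ∏ j ∈ S, a j ≤ A ^ S.card := by
      rw [← Finset.prod_const]
      exact Finset.prod_le_prod (fun j _ => (hb j).trans (hba j)) fun j _ => haA j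
    have h2 : 0 ≤ ∏ j ∈ S, a j := Finset.prod_nonneg fun j _ => (hb j).trans (hba j)
    have h3 : ∏ j ∈ S, b j ≤ ∏ j ∈ S, a j :=
      Finset.prod_le_prod (fun j _ => hb j) fun j _ => hba j
    have hA0 : 0 ≤ A := by linarith
    calc a i * ∏ j ∈ S, a j - b i * ∏ j ∈ S, b j
        = (a i - b i) * ∏ j ∈ S, a j + b i * (∏ j ∈ S, a j - ∏ j ∈ S, b j) := by ring
      _ ≤ ε * A ^ S.card + A * (S.card * A ^ S.card * ε) :=
          add_le_add (mul_le_mul (hab i) h1 h2 hε)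
            (mul_le_mul ((hba i).trans (haA i)) ih (by linarith) hA0)
      _ ≤ A * (ε * A ^ S.card) + A * (S.card * A ^ S.card * ε) := by
          have : ε * A ^ S.card ≤ A * (ε * A ^ S.card) :=
            le_mul_of_one_le_left (by positivity) hA
          linarith
      _ = _ := by push_cast; ring

/-! ### The leading constant and the exact decomposition of the determinant. -/

namespace DiscreteTorus

variable {d : ℕ}

lemma returnProb_pow (d : ℕ) (t : ℝ) :
    returnProb t ^ d = Real.exp (-(2 * d * t)) * besselI 0 (2 * t) ^ d := by
  rw [returnProb, mul_pow, ← Real.exp_nat_mul]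
  congr 2; ring

lemma one_div_sqrt_eq_rpow {t : ℝ} (ht : 0 < t) : 1 / √t = t ^ (-(1 / 2) : ℝ) := by
  rw [Real.rpow_neg ht.le, ← Real.sqrt_eq_rpow, one_div]

lemma exp_neg_mul_le_rpow {c t : ℝ} (hc : 0 < c) (ht : 1 ≤ t) :
    Real.exp (-(c * t)) ≤ c⁻¹ * t ^ (-(1 / 2) : ℝ) := by
  refine (exp_neg_le_inv_mul hc (by linarith)).trans ?_
  have : t ^ (-1 : ℝ) ≤ t ^ (-(1 / 2) : ℝ) := Real.rpow_le_rpow_of_exponent_le ht (by norm_num)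
  gcongr

theorem integrableOn_leadIntegrand (hd : 1 ≤ d) : IntegrableOn (leadIntegrand d) (Ioi 0) := by
  have hg : ContinuousOn (fun t => returnProb t ^ d - Real.exp (-t)) (Ioi 0) :=
    ((continuousOn_returnProb.mono Ioi_subset_Ici_self).pow d).sub (by fun_prop)
  have h := integrableOn_Ioi_zero_div_self hg (C := d * 2 + 1) (D := 1 + 1) (r := 1 / 2)
    (by norm_num) (fun t ht => ?_) (fun t (ht : 1 < t) => ?_)
  · refine h.congr_fun (fun t _ => ?_) measurableSet_Ioi
    simp only [leadIntegrand, returnProb_pow]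
  · have h0 := returnProb_nonneg ht.1.le
    have h1 := returnProb_le_one ht.1.le
    have h2 : 1 - d * (2 * t) ≤ returnProb t ^ d := by
      have h := one_add_mul_le_pow (a := returnProb t - 1) (by linarith) d
      rw [add_sub_cancel] at h
      have h3 := one_sub_le_returnProb ht.1.le
      have : (d : ℝ) * (-(2 * t)) ≤ d * (returnProb t - 1) := by gcongr; linarith
      linarith
    have h3 := pow_le_one₀ h0 h1 (n := d)
    have h4 := abs_le.1 (abs_exp_sub_one_le ht.1.le)
    have h5 : 0 ≤ d * (2 * t) := by have := ht.1; positivity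
    rw [abs_le]
    constructor <;> linarith [h4.1, h4.2, ht.1]
  · have ht0 : 0 < t := by linarith
    have h0 := returnProb_nonneg ht0.le
    have h1 : returnProb t ^ d ≤ t ^ (-(1 / 2) : ℝ) := by
      rw [← one_div_sqrt_eq_rpow ht0]
      exact (pow_le_of_le_one h0 (returnProb_le_one ht0.le) (by omega)).trans
        (returnProb_le_inv_sqrt ht0)
    have h2 := exp_neg_mul_le_rpow one_pos ht.le
    rw [one_mul, inv_one, one_mul] at h2
    have h3 := Real.exp_pos (-t)
    have h4 : 0 ≤ returnProb t ^ d := pow_nonneg h0 d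
    rw [abs_le]
    constructor <;> linarith

section LeadConst

lemma eqOn_bessel_sub_one (d : ℕ) :
    EqOn (fun t : ℝ => Real.exp (-(2 * d * t)) * (besselI 0 (2 * t) ^ d - 1) / t)
      (fun t => leadIntegrand d t + (Real.exp (-t) - Real.exp (-(2 * d * t))) / t) (Ioi 0) := by
  intro t _
  simp only [leadIntegrand]
  ring

theorem integrableOn_bessel_sub_one (hd : 1 ≤ d) :
    IntegrableOn (fun t : ℝ => Real.exp (-(2 * d * t)) * (besselI 0 (2 * t) ^ d - 1) / t)
      (Ioi 0) := by
  have hd' : (0 : ℝ) < 2 * d := by have : (0 : ℝ) < d := by exact_mod_cast hd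
                                   positivity
  exact ((integrableOn_leadIntegrand hd).add (integrableOn_exp_sub_exp_div hd')).congr_fun
    (eqOn_bessel_sub_one d).symm measurableSet_Ioi

theorem leadConst_eq_log_sub (hd : 1 ≤ d) :
    leadConst d = Real.log (2 * d) -
      ∫ t in Ioi (0 : ℝ), Real.exp (-(2 * d * t)) * (besselI 0 (2 * t) ^ d - 1) / t := by
  have hd' : (0 : ℝ) < 2 * d := by have : (0 : ℝ) < d := by exact_mod_cast hd
                                   positivity
  rw [setIntegral_congr_fun measurableSet_Ioi (eqOn_bessel_sub_one d),
    integral_add (integrableOn_leadIntegrand hd) (integrableOn_exp_sub_exp_div hd'),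
    integral_exp_sub_exp_div hd', leadConst]
  ring

lemma integral_bessel_rescale (d : ℕ) :
    ∫ t in Ioi (0 : ℝ), Real.exp (-(2 * d * t)) * (besselI 0 (2 * t) ^ d - 1) / t =
      ∫ t in Ioi (0 : ℝ), Real.exp (-(d * t)) * (besselI 0 t ^ d - 1) / t := by
  have h := integral_comp_mul_left_Ioi'
    (fun t : ℝ => Real.exp (-(d * t)) * (besselI 0 t ^ d - 1) / t) 0 two_pos
  rw [mul_zero] at h
  rw [← h, smul_eq_mul, ← integral_const_mul]
  refine setIntegral_congr_fun measurableSet_Ioi fun t (ht : 0 < t) => ?_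
  rw [show (d : ℝ) * (2 * t) = 2 * d * t by ring]
  field_simp

end LeadConst

section Determinant

/-- Of the `V` copies of `e^{-t}` in `V` times the leading integrand, `V - 1` pair with nonzero
eigenvalues; the last is the `+ e^{-t}` of the remainder. -/
lemma remIntegrand_eq (N : Fin d → ℕ+) (t : ℝ) :
    remIntegrand N t = -(∑ k ∈ Finset.univ.erase (0 : Vertex N),
      (Real.exp (-t) - Real.exp (-(torusEigenvalue N k * t))) / t) -
        vol N * leadIntegrand d t := by
  classical
  have h1 := Finset.add_sum_erase Finset.univ
    (fun k : Vertex N => Real.exp (-torusEigenvalue N k * t)) (Finset.mem_univ 0)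
  have h2 : ((Finset.univ.erase (0 : Vertex N)).card : ℝ) = vol N - 1 := by
    rw [Finset.card_erase_of_mem (Finset.mem_univ _), Finset.card_univ,
      Nat.cast_pred Fintype.card_pos, vol_eq_card]
  rw [← theta_eq_sum] at h1
  simp only [torusEigenvalue_zero, neg_zero, zero_mul, Real.exp_zero, neg_mul] at h1
  rw [← Finset.sum_div, Finset.sum_sub_distrib, Finset.sum_const, nsmul_eq_mul, h2, remIntegrand,
    leadIntegrand, ← h1]
  ring

lemma integrableOn_eigenvalue_sum (N : Fin d → ℕ+) :
    IntegrableOn (fun t => ∑ k ∈ Finset.univ.erase (0 : Vertex N),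
      (Real.exp (-t) - Real.exp (-(torusEigenvalue N k * t))) / t) (Ioi 0) :=
  integrable_finsetSum _ fun _ hk =>
    integrableOn_exp_sub_exp_div (torusEigenvalue_pos (Finset.ne_of_mem_erase hk))

theorem integrableOn_remIntegrand (hd : 1 ≤ d) (N : Fin d → ℕ+) :
    IntegrableOn (remIntegrand N) (Ioi 0) := by
  rw [funext (remIntegrand_eq N)]
  exact (integrableOn_eigenvalue_sum N).neg.sub ((integrableOn_leadIntegrand hd).const_mul _)

/-- The exact decomposition of the logarithm of the determinant. -/
theorem log_detStar_eq (hd : 1 ≤ d) (N : Fin d → ℕ+) :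
    Real.log (detStar N) = vol N * leadConst d + remTerm N := by
  have h : ∫ t in Ioi (0 : ℝ), ∑ k ∈ Finset.univ.erase (0 : Vertex N),
      (Real.exp (-t) - Real.exp (-(torusEigenvalue N k * t))) / t = Real.log (detStar N) := by
    rw [integral_finsetSum _ fun _ hk =>
      integrableOn_exp_sub_exp_div (torusEigenvalue_pos (Finset.ne_of_mem_erase hk)), log_detStar]
    exact Finset.sum_congr rfl fun k hk =>
      integral_exp_sub_exp_div (torusEigenvalue_pos (Finset.ne_of_mem_erase hk))
  have h2 : ∫ t in Ioi (0 : ℝ), remIntegrand N t = -Real.log (detStar N) -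
      vol N * ∫ t in Ioi (0 : ℝ), leadIntegrand d t := by
    rw [← h, ← integral_neg, ← integral_const_mul, ← integral_sub
      (integrableOn_eigenvalue_sum N).fun_neg ((integrableOn_leadIntegrand hd).const_mul _)]
    exact integral_congr_ae (ae_of_all _ (remIntegrand_eq N))
  rw [remTerm, h2, leadConst]
  ring

end Determinant

/-! ### Parabolic rescaling and uniform bounds. -/

section Rescaling

/-- The integrand of the remainder after parabolic scaling, with the cut-off at scale one. -/
def scaledIntegrand (N : Fin d → ℕ+) (u s : ℝ) : ℝ :=
  (∏ j, circleTheta (N j) (u ^ 2 * s) - ∏ j, (N j * returnProb (u ^ 2 * s)) - 1 +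
    Real.exp (-s)) / s

lemma scaledIntegrand_eq (N : Fin d → ℕ+) {u : ℝ} (hu : 0 < u) {s : ℝ} (hs : 0 < s) :
    scaledIntegrand N u s = u ^ 2 * remIntegrand N (u ^ 2 * s) +
      (Real.exp (-s) - Real.exp (-(u ^ 2 * s))) / s := by
  rw [scaledIntegrand, remIntegrand, theta_eq_prod, Finset.prod_mul_distrib, Finset.prod_const,
    Finset.card_univ, Fintype.card_fin, returnProb_pow, vol]
  field_simp
  ring

lemma integrableOn_scaledIntegrand (hd : 1 ≤ d) (N : Fin d → ℕ+) {u : ℝ} (hu : 0 < u) :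
    IntegrableOn (scaledIntegrand N u) (Ioi 0) := by
  have h := (integrableOn_Ioi_comp_mul_left_iff (remIntegrand N) 0 (pow_pos hu 2)).2
    (by simpa using integrableOn_remIntegrand hd N)
  exact IntegrableOn.congr_fun
    ((h.const_mul (u ^ 2)).add (integrableOn_exp_sub_exp_div (pow_pos hu 2)))
    (fun s hs => (scaledIntegrand_eq N hu hs).symm) measurableSet_Ioi

lemma remTerm_eq (hd : 1 ≤ d) (N : Fin d → ℕ+) {u : ℝ} (hu : 0 < u) :
    remTerm N = Real.log (u ^ 2) - ∫ s in Ioi (0 : ℝ), scaledIntegrand N u s := by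
  have h := (integrableOn_Ioi_comp_mul_left_iff (remIntegrand N) 0 (pow_pos hu 2)).2
    (by simpa using integrableOn_remIntegrand hd N)
  have h2 := integral_comp_mul_left_Ioi' (remIntegrand N) 0 (pow_pos hu 2)
  rw [mul_zero, smul_eq_mul] at h2
  rw [setIntegral_congr_fun measurableSet_Ioi fun s hs => scaledIntegrand_eq N hu hs,
    integral_add (h.const_mul (u ^ 2)) (integrableOn_exp_sub_exp_div (pow_pos hu 2)),
    integral_const_mul, h2, integral_exp_sub_exp_div (pow_pos hu 2), remTerm]
  ring

end Rescaling

section Bounds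

variable {n : ℕ → ℕ+} {β : ℝ}

lemma eventually_mul_returnProb_le (hβ : 0 < β)
    (hn : Tendsto (fun u : ℕ => ((n u : ℕ) : ℝ) / (u : ℝ)) atTop (𝓝 β)) :
    ∀ᶠ u : ℕ in atTop, ∀ s : ℝ, 0 < s →
      n u * returnProb ((u : ℝ) ^ 2 * s) ≤ 2 * β * (1 / √s) := by
  filter_upwards [eventually_le_mul hβ hn] with u ⟨hu, _, h2⟩ s hs
  have hs' := Real.sqrt_pos.2 hs
  have h := returnProb_le_inv_sqrt (t := (u : ℝ) ^ 2 * s) (by positivity)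
  have h0 := returnProb_nonneg (t := (u : ℝ) ^ 2 * s) (by positivity)
  rw [Real.sqrt_mul (by positivity), Real.sqrt_sq hu.le] at h
  calc _ ≤ 2 * β * u * (1 / (u * √s)) := by gcongr
    _ = _ := by field_simp

lemma eventually_circleTheta_sub_le (hβ : 0 < β)
    (hn : Tendsto (fun u : ℕ => ((n u : ℕ) : ℝ) / (u : ℝ)) atTop (𝓝 β)) {M : ℕ} (hM : 0 < M) :
    ∃ K : ℝ, 0 ≤ K ∧ ∀ᶠ u : ℕ in atTop, ∀ s : ℝ, 0 < s →
      circleTheta (n u) ((u : ℝ) ^ 2 * s) - n u * returnProb ((u : ℝ) ^ 2 * s) ≤ K * s ^ M := by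
  -- The bound is in powers of `√t / n`, hence the doubled exponent; with `t = u² s` and `n` of
  -- order `u` it becomes a power of `s`.
  obtain ⟨C, hC, h⟩ := exists_circleTheta_sub_le (j := 2 * M) (by omega)
  refine ⟨C * (4 / β ^ 2) ^ M, by positivity, ?_⟩
  have hlarge : ∀ᶠ u : ℕ in atTop, 2 * (2 * M) ≤ (n u : ℕ) := by
    have h1 : Tendsto (fun u : ℕ => β / 2 * (u : ℝ)) atTop atTop :=
      tendsto_natCast_atTop_atTop.const_mul_atTop (half_pos hβ)
    filter_upwards [eventually_le_mul hβ hn, h1.eventually_ge_atTop ((2 * (2 * M) : ℕ) : ℝ)]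
      with u h2 h3
    exact_mod_cast h3.trans h2.2.1
  filter_upwards [eventually_le_mul hβ hn, hlarge] with u ⟨hu, h1, _⟩ hl s hs
  have hn0 : (0 : ℝ) < n u := by exact_mod_cast (n u).pos
  refine (h (n u) ((u : ℝ) ^ 2 * s) hl (by positivity)).trans ?_
  rw [mul_assoc, ← mul_pow, pow_mul, div_pow, Real.sq_sqrt (by positivity)]
  have : (u : ℝ) ^ 2 * s / (n u : ℝ) ^ 2 ≤ 4 / β ^ 2 * s := by
    rw [div_le_iff₀ (by positivity)]
    calc (u : ℝ) ^ 2 * s = 4 / β ^ 2 * s * (β / 2 * u) ^ 2 := by field_simp; ring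
      _ ≤ _ := by gcongr
  gcongr

end Bounds

/-! ### Dominated convergence and the asymptotics. -/

section Convergence

variable {α : Fin d → ℝ} {N : ℕ → Fin d → ℕ+}

lemma tendsto_scaledIntegrand (hα : ∀ j, 0 < α j)
    (hN : ∀ j, Tendsto (fun u : ℕ => ((N u j : ℕ) : ℝ) / (u : ℝ)) atTop (𝓝 (α j)))
    {s : ℝ} (hs : 0 < s) :
    Tendsto (fun u : ℕ => scaledIntegrand (N u) u s) atTop
      (𝓝 (RealTorus.derivIntegrand α s)) := by
  have h1 := tendsto_finsetProd Finset.univ fun j _ => tendsto_circleTheta (hα j) (hN j) hs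
  have h2 := tendsto_finsetProd Finset.univ fun j _ => tendsto_mul_returnProb (hN j) hs
  have e : ∏ j, (α j * (1 / √(4 * Real.pi) * (1 / √s))) =
      RealTorus.thetaCoeff α * s ^ (-((d : ℝ) / 2)) := by
    simp_rw [← mul_assoc, Finset.prod_mul_distrib]
    rw [Finset.prod_const (1 / √s), Finset.card_univ, Fintype.card_fin, one_div_sqrt_eq_rpow hs,
      ← Real.rpow_mul_natCast hs.le, RealTorus.thetaCoeff, Finset.prod_div_distrib,
      Finset.prod_div_distrib, Finset.prod_const_one, mul_one_div]
    congr 2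
    ring
  rw [e] at h2
  exact (((h1.sub h2).sub_const 1).add_const _).div_const s

lemma eventually_abs_scaledIntegrand_le_const (hα : ∀ j, 0 < α j)
    (hN : ∀ j, Tendsto (fun u : ℕ => ((N u j : ℕ) : ℝ) / (u : ℝ)) atTop (𝓝 (α j))) :
    ∃ C : ℝ, ∀ᶠ u : ℕ in atTop, ∀ s ∈ Ioc (0 : ℝ) 1, |scaledIntegrand (N u) u s| ≤ C := by
  -- Order `d + 1`: `d` powers of `s` outweigh the factors `1 / √s` in the telescoped product, and
  -- the last pays for the division by `s`.
  choose K hK hKs using fun j => eventually_circleTheta_sub_le (hα j) (hN j) d.succ_pos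
  set L : ℝ := 1 + ∑ j, (K j + 2 * α j) with hL
  have hnn (j : Fin d) : 0 ≤ K j + 2 * α j := by linarith [hK j, hα j]
  have hKL (j : Fin d) : K j + 2 * α j ≤ L := by
    have := Finset.single_le_sum (fun j _ => hnn j) (Finset.mem_univ j)
    linarith
  have hL1 : 1 ≤ L := by
    have := Finset.sum_nonneg fun j (_ : j ∈ Finset.univ) => hnn j
    linarith
  refine ⟨d * L ^ (d + 1) + 1, ?_⟩
  filter_upwards [eventually_all.2 hKs,
    eventually_all.2 fun j => eventually_mul_returnProb_le (hα j) (hN j)] with u h1 h2 s hs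
  have hs0 := hs.1
  have hsq := Real.sqrt_pos.2 hs0
  have hs1 : √s ≤ 1 := Real.sqrt_le_one.2 hs.2
  have hss : s ≤ √s := by
    conv_lhs => rw [← Real.mul_self_sqrt hs0.le]
    exact mul_le_of_le_one_left hsq.le hs1
  have ht : 0 ≤ (u : ℝ) ^ 2 * s := by positivity
  have hb (j : Fin d) : 0 ≤ N u j * returnProb ((u : ℝ) ^ 2 * s) :=
    mul_nonneg (Nat.cast_nonneg _) (returnProb_nonneg ht)
  have hba (j : Fin d) := mul_returnProb_le_circleTheta (N u j) ht
  have hab (j : Fin d) : circleTheta (N u j) ((u : ℝ) ^ 2 * s) -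
      N u j * returnProb ((u : ℝ) ^ 2 * s) ≤ L * s ^ (d + 1) := by
    refine (h1 j s hs0).trans ?_
    have : K j ≤ L := by linarith [hKL j, hα j]
    gcongr
  have hA : 1 ≤ L * (1 / √s) := by
    rw [mul_one_div, le_div_iff₀ hsq]; linarith
  have haA (j : Fin d) : circleTheta (N u j) ((u : ℝ) ^ 2 * s) ≤ L * (1 / √s) := by
    have e1 : K j * s ^ (d + 1) ≤ K j * (1 / √s) := by
      have h3 : s ^ (d + 1) ≤ 1 := pow_le_one₀ hs0.le hs.2
      have h4 : 1 ≤ 1 / √s := by rw [le_div_iff₀ hsq]; linarith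
      have := hK j
      gcongr
      linarith
    have e2 : circleTheta (N u j) ((u : ℝ) ^ 2 * s) -
        N u j * returnProb ((u : ℝ) ^ 2 * s) ≤ K j * s ^ (d + 1) := h1 j s hs0
    calc _ ≤ K j * (1 / √s) + 2 * α j * (1 / √s) := by linarith [h2 j s hs0]
      _ = (K j + 2 * α j) * (1 / √s) := by ring
      _ ≤ _ := by gcongr; exact hKL j
  have hdiff := prod_sub_prod_le Finset.univ hA (by positivity) hb hba haA hab
  rw [Finset.card_univ, Fintype.card_fin] at hdiff
  have hdiff0 := Finset.prod_le_prod (s := Finset.univ) (fun j _ => hb j) fun j _ => hba j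
  have hpow : (L * (1 / √s)) ^ d * (L * s ^ (d + 1)) ≤ L ^ (d + 1) * s := by
    rw [mul_pow, one_div_pow]
    calc L ^ d * (1 / √s ^ d) * (L * s ^ (d + 1)) = L ^ (d + 1) * s * (s ^ d / √s ^ d) := by ring
      _ ≤ L ^ (d + 1) * s * 1 := by
          gcongr
          rw [div_le_one (by positivity)]
          gcongr
      _ = _ := mul_one _
  have hexp := abs_le.1 (abs_exp_sub_one_le hs0.le)
  have hd0 : (d : ℝ) * ((L * (1 / √s)) ^ d * (L * s ^ (d + 1))) ≤ d * (L ^ (d + 1) * s) := by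
    gcongr
  rw [scaledIntegrand, abs_div, abs_of_pos hs0, div_le_iff₀ hs0, abs_le]
  constructor <;> linarith [hexp.1, hexp.2]

lemma eventually_abs_scaledIntegrand_le_rpow (hd : 1 ≤ d) (hα : ∀ j, 0 < α j)
    (hN : ∀ j, Tendsto (fun u : ℕ => ((N u j : ℕ) : ℝ) / (u : ℝ)) atTop (𝓝 (α j))) :
    ∃ C : ℝ, ∀ᶠ u : ℕ in atTop, ∀ s ∈ Ioi (1 : ℝ),
      |scaledIntegrand (N u) u s| ≤ C * s ^ (-(3 / 2) : ℝ) := by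
  obtain ⟨K, a, hK, ha, h⟩ := exists_prod_gaussTheta_le Finset.univ
    (c := fun j => 4 / α j ^ 2) fun j => by have := hα j; positivity
  refine ⟨K * a⁻¹ + ∏ j, (2 * α j) + 1, ?_⟩
  filter_upwards [eventually_all.2 fun j => eventually_circleTheta_le (hα j) (hN j),
    eventually_all.2 fun j => eventually_mul_returnProb_le (hα j) (hN j)] with u h1 h2 s hs
  have hs1 : 1 < s := hs
  have hs0 : 0 < s := by linarith
  have hsq := Real.sqrt_pos.2 hs0
  have ht : 0 ≤ (u : ℝ) ^ 2 * s := by positivity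
  have e1 : ∏ j, circleTheta (N u j) ((u : ℝ) ^ 2 * s) ≤ 1 + K * (a⁻¹ * s ^ (-(1 / 2) : ℝ)) := by
    refine (Finset.prod_le_prod (fun j _ => zero_le_one.trans (one_le_circleTheta _ _))
      fun j _ => h1 j s hs0).trans ((h s hs1.le).trans ?_)
    rw [neg_mul]
    have := exp_neg_mul_le_rpow ha hs1.le
    gcongr
  have e2 : 1 ≤ ∏ j, circleTheta (N u j) ((u : ℝ) ^ 2 * s) :=
    Finset.prod_induction _ (1 ≤ ·) (fun _ _ => one_le_mul_of_one_le_of_one_le) le_rfl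
      fun j _ => one_le_circleTheta _ _
  have e3 : 0 ≤ ∏ j, (N u j * returnProb ((u : ℝ) ^ 2 * s)) :=
    Finset.prod_nonneg fun j _ => mul_nonneg (Nat.cast_nonneg _) (returnProb_nonneg ht)
  have e4 : ∏ j, (N u j * returnProb ((u : ℝ) ^ 2 * s)) ≤
      (∏ j, (2 * α j)) * s ^ (-(1 / 2) : ℝ) := by
    refine (Finset.prod_le_prod (fun j _ => mul_nonneg (Nat.cast_nonneg _)
      (returnProb_nonneg ht)) fun j _ => h2 j s hs0).trans ?_
    rw [Finset.prod_mul_distrib, Finset.prod_const, Finset.card_univ, Fintype.card_fin,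
      ← one_div_sqrt_eq_rpow hs0]
    have h3 : 1 / √s ≤ 1 := by
      rw [div_le_one hsq]; exact Real.one_le_sqrt.2 hs1.le
    -- Here `d ≥ 1` enters: a single factor `s^{-1/2}`, with the division by `s`, gives the
    -- integrable majorant `s^{-3/2}`.
    have h4 : (1 / √s) ^ d ≤ 1 / √s := pow_le_of_le_one (by positivity) h3 (by omega)
    have h5 : 0 ≤ ∏ j, (2 * α j) := Finset.prod_nonneg fun j _ => by linarith [hα j]
    gcongr
  have e5 := exp_neg_mul_le_rpow one_pos hs1.le
  rw [one_mul, inv_one, one_mul] at e5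
  have e6 := Real.exp_pos (-s)
  have e7 : 0 ≤ K * (a⁻¹ * s ^ (-(1 / 2) : ℝ)) := by positivity
  have e8 : s ^ (-(3 / 2) : ℝ) = s ^ (-(1 / 2) : ℝ) / s := by
    rw [← Real.rpow_sub_one hs0.ne']; norm_num
  have e9 : 0 ≤ s ^ (-(1 / 2) : ℝ) := by positivity
  rw [scaledIntegrand, abs_div, abs_of_pos hs0, e8, ← mul_div_assoc]
  gcongr
  rw [abs_le]
  constructor <;> linarith

theorem tendsto_integral_scaledIntegrand (hd : 1 ≤ d) (hα : ∀ j, 0 < α j)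
    (hN : ∀ j, Tendsto (fun u : ℕ => ((N u j : ℕ) : ℝ) / (u : ℝ)) atTop (𝓝 (α j))) :
    Tendsto (fun u : ℕ => ∫ s in Ioi (0 : ℝ), scaledIntegrand (N u) u s) atTop
      (𝓝 (∫ s in Ioi (0 : ℝ), RealTorus.derivIntegrand α s)) := by
  obtain ⟨C, hC⟩ := eventually_abs_scaledIntegrand_le_const hα hN
  obtain ⟨D, hD⟩ := eventually_abs_scaledIntegrand_le_rpow hd hα hN
  refine tendsto_integral_filter_of_dominated_convergence
    (fun s => (Ioc 0 1).indicator (fun _ => C) s +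
      (Ioi 1).indicator (fun s : ℝ => D * s ^ (-(3 / 2) : ℝ)) s) ?_ ?_ ?_ ?_
  · filter_upwards [eventually_gt_atTop 0] with u hu
    exact (integrableOn_scaledIntegrand hd (N u) (by exact_mod_cast hu)).aestronglyMeasurable
  · filter_upwards [hC, hD] with u h1 h2
    filter_upwards [ae_restrict_mem measurableSet_Ioi] with s (hs : 0 < s)
    rcases le_or_gt s 1 with h | h
    · have hm : s ∈ Ioc (0 : ℝ) 1 := ⟨hs, h⟩
      have hm' : s ∉ Ioi (1 : ℝ) := not_lt.2 h
      rw [indicator_of_mem hm, indicator_of_notMem hm', add_zero]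
      exact h1 s hm
    · have hm : s ∉ Ioc (0 : ℝ) 1 := fun h' => not_lt.2 h'.2 h
      rw [indicator_of_notMem hm, indicator_of_mem (mem_Ioi.2 h), zero_add]
      exact h2 s h
  · have h1 : Integrable ((Ioc (0 : ℝ) 1).indicator fun _ => C) :=
      (integrableOn_const (by simp)).integrable_indicator measurableSet_Ioc
    have h2 : Integrable ((Ioi (1 : ℝ)).indicator fun s : ℝ => D * s ^ (-(3 / 2) : ℝ)) :=
      IntegrableOn.integrable_indicator
        ((integrableOn_Ioi_rpow_of_lt (by norm_num) one_pos).const_mul D) measurableSet_Ioi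
    exact (h1.add h2).integrableOn
  · filter_upwards [ae_restrict_mem measurableSet_Ioi] with s hs
    exact tendsto_scaledIntegrand hα hN hs

/-- The asymptotics of the remainder in the decomposition of the determinant. -/
theorem tendsto_remTerm_sub (hd : 1 ≤ d) (hα : ∀ j, 0 < α j)
    (hN : ∀ j, Tendsto (fun u : ℕ => ((N u j : ℕ) : ℝ) / (u : ℝ)) atTop (𝓝 (α j))) :
    Tendsto (fun u : ℕ => (remTerm (N u) : ℂ) - (Real.log ((u : ℝ) ^ 2) -
      deriv (RealTorus.spectralZeta (Matrix.diagonal α)) 0)) atTop (𝓝 0) := by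
  have h1 := (tendsto_integral_scaledIntegrand hd hα hN).const_sub
    (∫ s in Ioi (0 : ℝ), RealTorus.derivIntegrand α s)
  rw [sub_self] at h1
  have h2 := (Complex.continuous_ofReal.tendsto 0).comp h1
  rw [Complex.ofReal_zero] at h2
  refine h2.congr' ?_
  filter_upwards [eventually_gt_atTop 0] with u hu
  rw [RealTorus.deriv_spectralZeta_eq_integral hd hα,
    remTerm_eq hd (N u) (by exact_mod_cast hu : (0 : ℝ) < u)]
  simp only [Function.comp_apply]
  push_cast
  ring

end Convergence

end DiscreteTorus

end

theorem theorem5p8 (d : ℕ) (hd : 1 ≤ d) (α : Fin d → ℝ) (hα : ∀ j, 0 < α j)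
    (N : ℕ → Fin d → ℕ+)
    (hN : ∀ j, Tendsto (fun u : ℕ => ((N u j : ℕ) : ℝ) / (u : ℝ)) atTop (𝓝 (α j))) :
    -- the spectral zeta function of the real torus exists as a meromorphic function
    (∀ t : ℝ, 0 < t →
      Summable fun m : Fin d → ℤ => Real.exp (-RealTorus.eigenvalue (Matrix.diagonal α) m * t)) ∧
    RealTorus.IsSpectralZeta (Matrix.diagonal α)
      (RealTorus.spectralZeta (Matrix.diagonal α)) ∧
    -- the integrals which define the two constants converge
    IntegrableOn (DiscreteTorus.leadIntegrand d) (Ioi 0) ∧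
    (∀ u, IntegrableOn (DiscreteTorus.remIntegrand (N u)) (Ioi 0)) ∧
    -- the asymptotic formula for the log-determinants
    (fun u : ℕ => (Real.log (DiscreteTorus.detStar (N u)) : ℂ) -
        ((DiscreteTorus.vol (N u) * DiscreteTorus.leadConst d : ℝ) + Real.log ((u : ℝ) ^ 2) +
          RealTorus.logDetStar (Matrix.diagonal α)))
      =o[atTop] (fun _ => (1 : ℝ)) ∧
    -- its equivalent form
    (fun u : ℕ => (DiscreteTorus.remTerm (N u) : ℂ) -
        (Real.log ((u : ℝ) ^ 2) - deriv (RealTorus.spectralZeta (Matrix.diagonal α)) 0))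
      =o[atTop] (fun _ => (1 : ℝ)) ∧
    -- the two other expressions for the constant in the lead term
    IntegrableOn (fun t : ℝ => Real.exp (-(2 * d * t)) *
      (DiscreteTorus.besselI 0 (2 * t) ^ d - 1) / t) (Ioi 0) ∧
    DiscreteTorus.leadConst d = Real.log (2 * d) -
      ∫ t in Ioi (0 : ℝ), Real.exp (-(2 * d * t)) *
        (DiscreteTorus.besselI 0 (2 * t) ^ d - 1) / t ∧
    DiscreteTorus.leadConst d = Real.log (2 * d) -
      ∫ t in Ioi (0 : ℝ), Real.exp (-(d * t)) * (DiscreteTorus.besselI 0 t ^ d - 1) / t := by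
  have hkey := DiscreteTorus.tendsto_remTerm_sub hd hα hN
  refine ⟨fun t ht => (RealTorus.hasSum_theta_diagonal hα ht).summable,
    RealTorus.isSpectralZeta_spectralZeta hd hα, DiscreteTorus.integrableOn_leadIntegrand hd,
    fun u => DiscreteTorus.integrableOn_remIntegrand hd (N u), ?_, ?_,
    DiscreteTorus.integrableOn_bessel_sub_one hd, DiscreteTorus.leadConst_eq_log_sub hd, ?_⟩
  · refine (isLittleO_one_iff ℝ).2 (hkey.congr fun u => ?_)
    rw [DiscreteTorus.log_detStar_eq hd, RealTorus.logDetStar]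
    push_cast
    ring
  · exact (isLittleO_one_iff ℝ).2 hkey
  · rw [← DiscreteTorus.integral_bessel_rescale]
    exact DiscreteTorus.leadConst_eq_log_sub hd
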